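/- **Setting.** An ultragraph $\mathcal G=(\mathcal G^0,\mathcal G^1,r,s)$ consists of countable sets $\mathcal G^0,\mathcal G^1$ and maps $s:\mathcal G^1\to\mathcal G^0$, $r:\mathcal G^1\to P(\mathcal G^0)$. Let $\mathcal E$ be the smallest family of subsets of $\mathcal G^0$ that contains $\emptyset$, all $\{v\}$ and all $r(e)$ and is closed under finite unions and intersections. Let $\mathrm{Reg}(\mathcal G)=\{v: 0<|s^{-1}(v)|<\infty\}$, $X\subseteq \mathrm{Reg}(\mathcal G)$ and $Y=\mathrm{Reg}(\mathcal G)\setminus X$. The algebra $C^*(\mathcal G,X)$ is the universal $C^*$-algebra generated by projections $p_A$ ($A\in\mathcal E$) and partial isometries $s_e$ ($e\in\mathcal G^1$) with orthogonal ranges such that $p_\emptyset=0$, $p_Ap_B=p_{A\cap B}$, $p_{A\cup B}=p_A+p_B-p_{A\cap B}$; $s_e^*s_e=p_{r(e)}$; $s_es_e^*\le p_{s(e)}$; and $p_v=\sum_{s(e)=v}s_es_e^*$ for $v\in X$. Put $C^*(\mathcal G)=C^*(\mathcal G,\mathrm{Reg}(\mathcal G))$. The ultragraph $\mathcal G_X$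 has vertices $\mathcal G^0\sqcup\{v':v\in Y\}$ and edges $\mathcal G^1\sqcup\{e': e\in\mathcal G^1,\ r(e)\cap Y\ne\emptyset\}$; its maps extend $s,r$ by $s_X(e')=s(e)$, $r_X(e')=(r(e)\cap Y)'=\{w':w\in r(e)\cap Y\}$. Let $\mathcal E_X$ be its family of vertex sets, and $P_Z,S_f$ the generators of $C^*(\mathcal G_X)$. Every $Z\in\mathcal E_X$ is $Z=A\cup(B\cap Y)'$ with $A,B\in\mathcal E$ and $A$, $B\cap Y$ unique. A *relative $(\mathcal G,X)$-branching system* on a measure space $(\mathcal X,\mu)$ consists of measurable sets $R_e,D_A\subseteq \mathcal X$ and measurable maps $f_e:D_{r(e)}\to R_e$, $f_e^{-1}:R_e\to D_{r(e)}$ (relations between sets and maps being understood $\mu$-a.e.) such that: $R_e\cap R_f=\emptyset$ a.e. for $e\neq f$; $D_\emptyset=\emptyset$, $D_A\cap D_B=D_{A\cap B}$ and $D_A\cup D_B=D_{A\cup B}$ a.e.; $R_e\subseteq D_{s(e)}$ a.e.; $D_v=\bigcup_{s(e)=v}R_e$ a.e. for $v\in X$; $f_e$ and $f_e^{-1}$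 are mutually inverse a.e.; and $\mu\circ f_e\ll\mu$ on $D_{r(e)}$, $\mu\circ f_e^{-1}\ll\mu$ on $R_e$, with Radon–Nikodym derivatives $\Phi_{f_e}$, $\Phi_{f_e^{-1}}$ (assumed to exist; this is automatic if $\mu$ is $\sigma$-finite). Here the image $f_e(T)$ of a measurable set $T$ is taken to be $\{y\in R_e: f_e^{-1}(y)\in T\}$. A $\mathcal G$-branching system is a relative $(\mathcal G,\mathrm{Reg}(\mathcal G))$-branching system. A representation $\eta$ of $C^*(\mathcal G,X)$ on $L^2(\mathcal X,\mu)$ is *induced* by the system if $\eta(s_e)\varphi=\Phi_{f_e^{-1}}^{1/2}\,(\varphi\circ f_e^{-1})\,\chi_{R_e}$ and $\eta(p_A)\varphi=\chi_{D_A}\varphi$ for all $e$, $A$, $\varphi$. **Theorem.** Let $\mathcal G$ be an ultragraph, $X\subseteq \mathrm{Reg}(\mathcal G)$ and $Y=\mathrm{Reg}(\mathcal G)\setminus X$, with $r(e)\cap Y$ finite for all $e\in\mathcal G^1$. Let $\{R_e,D_A,f_e\}$ be a relative $(\mathcal G,X)$-branching system on $(\mathcal X,\mu)$. For $v\in Y$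 put $N_v=D_v\setminus\bigcup_{s(g)=v}R_g$. For $Z=A\cup(B\cap Y)'\in\mathcal E_X$ put $$B_Z=(D_A\setminus D_{A\cap Y})\cup\bigcup_{s(g)\in A\cap Y}R_g\cup\bigcup_{v\in B\cap Y}N_v,$$ for $e\in\mathcal G^1$ put $$Q_e=\bigl(f_e(D_{r(e)})\setminus f_e(D_{r(e)\cap Y})\bigr)\cup f_e\Bigl(\bigcup_{s(g)\in r(e)\cap Y}R_g\Bigr),$$ and, if $r(e)\cap Y\neq\emptyset$, put $Q_{e'}=f_e\bigl(\bigcup_{v\in r(e)\cap Y}N_v\bigr)$. Let $g_e$ and $g_{e'}$ be the restrictions of $f_e$ to $B_{r(e)}$ and $B_{r_X(e')}$. Then: 1. $\{Q_f,B_Z,g_f\}_{f\in\mathcal G_X^1,\,Z\in\mathcal E_X}$ is a $\mathcal G_X$-branching system on $(\mathcal X,\mu)$. 2. There are a unique representation $\eta$ of $C^*(\mathcal G,X)$ induced by $\{R_e,D_A,f_e\}$ and a unique representation $\pi$ of $C^*(\mathcal G_X)$ induced by $\{Q_f,B_Z,g_f\}$. 3. There is a unique $*$-homomorphism $\psi:C^*(\mathcal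 G_X)\to C^*(\mathcal G,X)$ such that, with $q_v=p_v-\sum_{s(g)=v}s_gs_g^*$, $$\psi(P_Z)=p_A-p_{A\cap Y}+\sum_{s(g)\in A\cap Y}s_gs_g^*+\sum_{v\in B\cap Y}q_v\qquad (Z=A\cup(B\cap Y)'),$$ $$\psi(S_e)=s_e\Bigl(p_{r(e)}-p_{r(e)\cap Y}+\sum_{s(g)\in r(e)\cap Y}s_gs_g^*\Bigr),\qquad \psi(S_{e'})=s_e\Bigl(p_{r(e)\cap Y}-\sum_{s(g)\in r(e)\cap Y}s_gs_g^*\Bigr),$$ and $\psi$ is an isomorphism. 4. $\pi=\eta\circ\psi$. -/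

import Mathlib

open MeasureTheory Set
open scoped ENNReal ComplexConjugate

universe u v w

noncomputable section

/-- Complex *-algebras with a C*-seminorm. -/
class SeminormedCStar (A : Type u) [NonUnitalSeminormedRing A] [StarRing A] : Prop
    extends NormedStarGroup A where
  norm_mul_self_le (a : A) : ‖a‖ * ‖a‖ ≤ ‖star a * a‖

/-- The Hausdorff completion of a *-algebra with a C*-seminorm, a C*-algebra. -/
def CStarCompletion (A : Type u) [NonUnitalSeminormedRing A] : Type u :=
  UniformSpace.Completion A

namespace CStarCompletion

open UniformSpace UniformSpace.Completion

variable (A : Type u) [NonUnitalSeminormedRing A] [NormedSpace ℂ A]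

instance : NormedAddCommGroup (CStarCompletion A) :=
  inferInstanceAs (NormedAddCommGroup (Completion A))
instance : NormedSpace ℂ (CStarCompletion A) :=
  inferInstanceAs (NormedSpace ℂ (Completion A))
instance : CompleteSpace (CStarCompletion A) :=
  inferInstanceAs (CompleteSpace (Completion A))

/-- The canonical map of the given *-algebra into the completion. -/
def of : A →ₗᵢ[ℂ] CStarCompletion A := toComplₗᵢ

variable {A}

lemma denseRange_of : DenseRange (of A) := denseRange_coe

lemma ind₁ {P : CStarCompletion A → Prop} (hP : IsClosed {x | P x}) (h : ∀ a, P (of A a)) (x : CStarCompletion A) :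
    P x := induction_on x hP h

lemma ind₂ {P : CStarCompletion A → CStarCompletion A → Prop} (hP : IsClosed {x : CStarCompletion A × CStarCompletion A | P x.1 x.2})
    (h : ∀ a b, P (of A a) (of A b)) (x y : CStarCompletion A) : P x y := induction_on₂ x y hP h

lemma ind₃ {P : CStarCompletion A → CStarCompletion A → CStarCompletion A → Prop}
    (hP : IsClosed {x : CStarCompletion A × CStarCompletion A × CStarCompletion A | P x.1 x.2.1 x.2.2})
    (h : ∀ a b c, P (of A a) (of A b) (of A c)) (x y z : CStarCompletion A) : P x y z :=
  induction_on₃ x y z hP h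

lemma norm_of (a : A) : ‖of A a‖ = ‖a‖ := (of A).norm_map a

/-- The product, extended from the given *-algebra by continuity. -/
instance : Mul (CStarCompletion A) :=
  ⟨Function.curry <| (isDenseInducing_coe.prodMap isDenseInducing_coe).extend
    ((of A) ∘ Function.uncurry (fun a b : A => a * b))⟩

lemma of_mul (a b : A) : of A (a * b) = of A a * of A b :=
  ((isDenseInducing_coe.prodMap isDenseInducing_coe).extend_eq
    ((of A).continuous.comp (continuous_mul (M := A))) (a, b)).symm

instance : ContinuousMul (CStarCompletion A) where
  continuous_mul := by
    let m := (AddMonoidHom.mul : A →+ A →+ A).compr₂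
      (of A).toLinearMap.toAddMonoidHom
    have hm : Continuous fun p : A × A => m p.1 p.2 :=
      (of A).continuous.comp continuous_mul
    have di : IsDenseInducing (toCompl : A → Completion A) :=
      isDenseInducing_coe
    exact (di.extend_Z_bilin di hm :)

variable [StarRing A] [StarModule ℂ A] [SeminormedCStar A]

/-- The involution, extended from the given *-algebra by continuity. -/
instance : Star (CStarCompletion A) := ⟨Completion.map star⟩

lemma star_of (a : A) : star (of A a) = of A (star a) :=
  map_coe (starₗᵢ ℂ : A ≃ₗᵢ⋆[ℂ] A).lipschitz.uniformContinuous a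

instance : ContinuousStar (CStarCompletion A) := ⟨Completion.continuous_map⟩

instance : NonUnitalNormedRing (CStarCompletion A) where
  __ := (inferInstance : NormedAddCommGroup (CStarCompletion A))
  __ := (inferInstance : Mul (CStarCompletion A))
  zero_mul a := by
    refine ind₁ (P := fun a => 0 * a = 0) (isClosed_eq (by fun_prop) (by fun_prop)) (fun a => ?_) a
    rw [← map_zero (of A), ← of_mul, zero_mul]
  mul_zero a := by
    refine ind₁ (P := fun a => a * 0 = 0) (isClosed_eq (by fun_prop) (by fun_prop)) (fun a => ?_) a
    rw [← map_zero (of A), ← of_mul, mul_zero]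
  mul_assoc a b c := by
    refine ind₃ (P := fun a b c => a * b * c = a * (b * c))
      (isClosed_eq (by fun_prop) (by fun_prop)) (fun a b c => ?_) a b c
    simp only [← of_mul, mul_assoc]
  left_distrib a b c := by
    refine ind₃ (P := fun a b c => a * (b + c) = a * b + a * c)
      (isClosed_eq (by fun_prop) (by fun_prop)) (fun a b c => ?_) a b c
    simp only [← of_mul, ← map_add, mul_add]
  right_distrib a b c := by
    refine ind₃ (P := fun a b c => (a + b) * c = a * c + b * c)
      (isClosed_eq (by fun_prop) (by fun_prop)) (fun a b c => ?_) a b c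
    simp only [← of_mul, ← map_add, add_mul]
  norm_mul_le a b := by
    refine ind₂ (P := fun a b => ‖a * b‖ ≤ ‖a‖ * ‖b‖)
      (isClosed_le (by fun_prop) (by fun_prop)) (fun a b => ?_) a b
    simpa only [← of_mul, norm_of] using norm_mul_le a b

instance : NormedSpace ℂ (CStarCompletion A) :=
  inferInstanceAs (NormedSpace ℂ (UniformSpace.Completion A))

variable [IsScalarTower ℂ A A] [SMulCommClass ℂ A A]

instance : IsScalarTower ℂ (CStarCompletion A) (CStarCompletion A) where
  smul_assoc c a b := by
    change c • a * b = c • (a * b)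
    refine ind₂ (P := fun a b => c • a * b = c • (a * b))
      (isClosed_eq ((continuous_fst.const_smul c).mul continuous_snd)
        ((continuous_fst.mul continuous_snd).const_smul c)) (fun a b => ?_) a b
    rw [← map_smul, ← of_mul, ← of_mul, ← map_smul, smul_mul_assoc]

instance : SMulCommClass ℂ (CStarCompletion A) (CStarCompletion A) where
  smul_comm c a b := by
    change c • (a * b) = a * (c • b)
    refine ind₂ (P := fun a b => c • (a * b) = a * (c • b))
      (isClosed_eq ((continuous_fst.mul continuous_snd).const_smul c)
        (continuous_fst.mul (continuous_snd.const_smul c))) (fun a b => ?_) a b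
    rw [← map_smul, ← of_mul, ← of_mul, ← map_smul, mul_smul_comm]

instance : NonUnitalCStarAlgebra (CStarCompletion A) where
  star_involutive a := by
    refine ind₁ (P := fun a => star (star a) = a) (isClosed_eq (by fun_prop) (by fun_prop))
      (fun a => ?_) a
    simp only [star_of, star_star]
  star_mul a b := by
    refine ind₂ (P := fun a b => star (a * b) = star b * star a)
      (isClosed_eq (by fun_prop) (by fun_prop)) (fun a b => ?_) a b
    simp only [star_of, ← of_mul, star_mul]
  star_add a b := by
    refine ind₂ (P := fun a b => star (a + b) = star a + star b)
      (isClosed_eq (by fun_prop) (by fun_prop)) (fun a b => ?_) a b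
    simp only [star_of, ← map_add, star_add]
  norm_mul_self_le a := by
    refine ind₁ (P := fun a => ‖a‖ * ‖a‖ ≤ ‖star a * a‖)
      (isClosed_le (by fun_prop) (by fun_prop)) (fun a => ?_) a
    simp only [star_of, ← of_mul, norm_of]
    exact SeminormedCStar.norm_mul_self_le a
  star_smul c a := by
    refine ind₁ (P := fun a => star (c • a) = star c • star a)
      (isClosed_eq (continuous_id.const_smul c).star (continuous_id.star.const_smul (star c))) (fun a => ?_) a
    simp only [star_of, ← map_smul, star_smul]

end CStarCompletion

/-- An ultragraph: countable sets of vertices and edges, a source map into vertices and a range map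
into sets of vertices. -/
structure Ultragraph where
  Vert : Type u
  Edge : Type v
  countable_vert : Countable Vert
  countable_edge : Countable Edge
  s : Edge → Vert
  r : Edge → Set Vert

namespace Ultragraph

/-- Membership in the smallest family of vertex sets that contains the singletons and the ranges
of edges and is closed under finite unions (the empty union included) and finite intersections of
at least one set. -/
inductive IsGen (G : Ultragraph.{u, v}) : Set G.Vert → Prop
  | empty : IsGen G ∅
  | singleton (a : G.Vert) : IsGen G {a}
  | range (e : G.Edge) : IsGen G (G.r e)
  | union {A B : Set G.Vert} : IsGen G A → IsGen G B → IsGen G (A ∪ B)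
  | inter {A B : Set G.Vert} : IsGen G A → IsGen G B → IsGen G (A ∩ B)

/-- The family `𝓔` attached to an ultragraph. -/
abbrev Fam (G : Ultragraph.{u, v}) : Type u := {A : Set G.Vert // G.IsGen A}

namespace Fam

variable {G : Ultragraph.{u, v}}

def empty : G.Fam := ⟨∅, .empty⟩
def vert (a : G.Vert) : G.Fam := ⟨{a}, .singleton a⟩
def range (e : G.Edge) : G.Fam := ⟨G.r e, .range e⟩
def union (A B : G.Fam) : G.Fam := ⟨A.1 ∪ B.1, .union A.2 B.2⟩
def inter (A B : G.Fam) : G.Fam := ⟨A.1 ∩ B.1, .inter A.2 B.2⟩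

end Fam

/-- The regular vertices: those that emit at least one and only finitely many edges. -/
def Reg (G : Ultragraph.{u, v}) : Set G.Vert :=
  {a | {e | G.s e = a}.Nonempty ∧ {e | G.s e = a}.Finite}

/-- `Y = Reg(G) \ X`. -/
def Y (G : Ultragraph.{u, v}) (X : Set G.Vert) : Set G.Vert := G.Reg \ X

/-- For a set `B` of vertices, `primed X B` is `(B ∩ Y)' = {b' | b ∈ B ∩ Y}`, where the disjoint
copy `y'` of `y ∈ Y` is `Sum.inr y`. -/
def primed (G : Ultragraph.{u, v}) (X B : Set G.Vert) : Set (G.Vert ⊕ ↥(G.Y X)) :=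
  {z | ∃ y : ↥(G.Y X), y.1 ∈ B ∧ z = Sum.inr y}

/-- The ultragraph `G_X`. A vertex `a` of `G` is `Sum.inl a`, the new vertices are the `Sum.inr y`
with `y ∈ Y`; an edge `e` of `G` is `Sum.inl e`, and the new edge `e'`, which exists if `r(e)`
meets `Y`, is `Sum.inr e`. -/
def ext (G : Ultragraph.{u, v}) (X : Set G.Vert) : Ultragraph.{u, v} where
  Vert := G.Vert ⊕ ↥(G.Y X)
  Edge := G.Edge ⊕ {e : G.Edge // (G.r e ∩ G.Y X).Nonempty}
  countable_vert := by
    have := G.countable_vert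
    infer_instance
  countable_edge := by
    have := G.countable_edge
    infer_instance
  s := Sum.elim (fun e => Sum.inl (G.s e)) (fun e => Sum.inl (G.s e.1))
  r := Sum.elim (fun e => Sum.inl '' G.r e) (fun e => G.primed X (G.r e.1))

section Decomposition

variable {G : Ultragraph.{u, v}} {X : Set G.Vert}

lemma isGen_of_finite {A : Set G.Vert} (hA : A.Finite) : G.IsGen A := by
  induction A, hA using Set.Finite.induction_on with
  | empty => exact .empty
  | insert _ _ ih =>
    rw [Set.insert_eq]
    exact .union (.singleton _) ih

lemma finite_inter_Y (hfin : ∀ e, (G.r e ∩ G.Y X).Finite) {A : Set G.Vert} (hA : G.IsGen A) :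
    (A ∩ G.Y X).Finite := by
  induction hA with
  | empty => simp
  | singleton a => exact (Set.finite_singleton a).inter_of_left _
  | range e => exact hfin e
  | union _ _ h1 h2 =>
    rw [Set.union_inter_distrib_right]
    exact h1.union h2
  | inter _ _ h1 _ => exact h1.subset (by intro x hx; exact ⟨hx.1.1, hx.2⟩)

/-- `A ∩ Y` as a member of `𝓔`, for `A ∈ 𝓔`, when all `r(e) ∩ Y` are finite. -/
def Fam.interY (hfin : ∀ e, (G.r e ∩ G.Y X).Finite) (A : G.Fam) : G.Fam :=
  ⟨A.1 ∩ G.Y X, isGen_of_finite (finite_inter_Y hfin A.2)⟩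

lemma isGen_preimage_inl {Z : Set (G.ext X).Vert} (hZ : (G.ext X).IsGen Z) :
    G.IsGen (Sum.inl ⁻¹' Z : Set G.Vert) := by
  induction hZ with
  | empty => exact .empty
  | singleton a =>
    rcases a with a | a
    · have h : (Sum.inl ⁻¹' {(Sum.inl a : G.Vert ⊕ ↥(G.Y X))} : Set G.Vert) = {a} := by
        ext x; simp
      exact h ▸ IsGen.singleton a
    · have h : (Sum.inl ⁻¹' {(Sum.inr a : G.Vert ⊕ ↥(G.Y X))} : Set G.Vert) = ∅ := by
        ext x; simp
      exact h ▸ IsGen.empty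
  | range e =>
    rcases e with e | e
    · have h : (Sum.inl ⁻¹' ((G.ext X).r (Sum.inl e)) : Set G.Vert) = G.r e := by
        ext x; simp [Ultragraph.ext]
      exact h ▸ IsGen.range e
    · have h : (Sum.inl ⁻¹' ((G.ext X).r (Sum.inr e)) : Set G.Vert) = ∅ := by
        ext x; simp [Ultragraph.ext, primed]
      exact h ▸ IsGen.empty
  | union _ _ h1 h2 => exact .union h1 h2
  | inter _ _ h1 h2 => exact .inter h1 h2

/-- The part `A ∈ 𝓔` of the unique decomposition `Z = A ∪ (B ∩ Y)'` of `Z ∈ 𝓔_X`. -/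
def Fam.base (Z : (G.ext X).Fam) : G.Fam := ⟨Sum.inl ⁻¹' Z.1, isGen_preimage_inl Z.2⟩

/-- The part `B ∩ Y` of the unique decomposition `Z = A ∪ (B ∩ Y)'` of `Z ∈ 𝓔_X`. -/
def Fam.top (Z : (G.ext X).Fam) : Set G.Vert :=
  {b | ∃ h : b ∈ G.Y X, (Sum.inr ⟨b, h⟩ : G.Vert ⊕ ↥(G.Y X)) ∈ Z.1}

lemma Fam.decomposition (Z : (G.ext X).Fam) :
    Z.1 = Sum.inl '' Z.base.1 ∪ G.primed X Z.top := by
  ext z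
  constructor
  · intro hz
    rcases z with a | y
    · exact Or.inl ⟨a, hz, rfl⟩
    · exact Or.inr ⟨y, ⟨y.2, hz⟩, rfl⟩
  · rintro (⟨a, ha, rfl⟩ | ⟨y, ⟨_, hy⟩, rfl⟩)
    · exact ha
    · exact hy

end Decomposition

/-! ### The relative ultragraph C*-algebra -/

section Algebra

/-- The generating symbols `s_e` and `p_A`, each with a formal adjoint (Boolean `true`). -/
abbrev Letter (G : Ultragraph.{u, v}) : Type (max u v) := (G.Edge ⊕ G.Fam) × Bool

variable (G : Ultragraph.{u, v})

instance : StarMul (FreeSemigroup G.Letter) where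
  star w := (FreeSemigroup.lift
    (fun l : G.Letter => MulOpposite.op (FreeSemigroup.of (l.1, !l.2))) w).unop
  star_involutive w := by
    induction w using FreeSemigroup.recOnMul with
    | ih1 l => simp
    | ih2 l w h1 h2 => simp_all [map_mul]
  star_mul a b := by simp

/-- The free non-unital complex algebra on the letters; its elements are the non-commutative
polynomials without constant term in the generators and their formal adjoints. -/
abbrev FreeAlg : Type (max u v) := MonoidAlgebra ℂ (FreeSemigroup G.Letter)

variable {G}

def starAddHom : G.FreeAlg →+ G.FreeAlg :=
  (Finsupp.liftAddHom (fun w : FreeSemigroup G.Letter =>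
    (MonoidAlgebra.singleAddHom (star w) : ℂ →+ G.FreeAlg).comp
      (starAddEquiv : ℂ ≃+ ℂ).toAddMonoidHom)).comp
    (MonoidAlgebra.coeffAddEquiv : G.FreeAlg ≃+ _).toAddMonoidHom

lemma starAddHom_single (w : FreeSemigroup G.Letter) (c : ℂ) :
    starAddHom (MonoidAlgebra.single w c : G.FreeAlg) = MonoidAlgebra.single (star w) (star c) := by
  simp [starAddHom, MonoidAlgebra.singleAddHom]

instance : StarRing G.FreeAlg where
  star := starAddHom
  star_involutive x := by
    induction x using MonoidAlgebra.induction_linear with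
    | zero => simp
    | add x y hx hy => rw [map_add, map_add, hx, hy]
    | single w c => simp [starAddHom_single]
  star_mul x y := by
    induction x using MonoidAlgebra.induction_linear with
    | zero => simp
    | add a b ha hb => simp only [add_mul, mul_add, map_add, ha, hb]
    | single w c =>
      induction y using MonoidAlgebra.induction_linear with
      | zero => simp
      | add a b ha hb => simp only [add_mul, mul_add, map_add, ha, hb]
      | single w' c' =>
        simp [starAddHom_single, MonoidAlgebra.single_mul_single, mul_comm]
  star_add x y := map_add _ x y

lemma star_single (w : FreeSemigroup G.Letter) (c : ℂ) :
    star (MonoidAlgebra.single w c : G.FreeAlg) = MonoidAlgebra.single (star w) (star c) :=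
  starAddHom_single w c

instance : StarModule ℂ G.FreeAlg where
  star_smul c x := by
    induction x using MonoidAlgebra.induction_linear with
    | zero => simp
    | add a b ha hb => simp only [smul_add, star_add, ha, hb]
    | single w d => simp [star_single, MonoidAlgebra.smul_single]

/-- The symbol `s_e`. -/
def symS (e : G.Edge) : G.FreeAlg :=
  MonoidAlgebra.single (FreeSemigroup.of (Sum.inl e, false)) 1

/-- The symbol `p_A`. -/
def symP (A : G.Fam) : G.FreeAlg :=
  MonoidAlgebra.single (FreeSemigroup.of (Sum.inr A, false)) 1

/-- The defining relations `lhs = rhs` of the relative ultragraph algebra: the `p_A` are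
projections, the `s_e` are partial isometries with mutually orthogonal ranges, and the relations
(1)-(3) hold, as well as the Cuntz-Krieger relation at each vertex of `X`. (For projections
`q ≤ p` means `p q = q`.) -/
inductive Rel (X : Set G.Vert) : G.FreeAlg → G.FreeAlg → Prop
  | p_selfAdjoint (A : G.Fam) : Rel X (star (symP A)) (symP A)
  | p_idem (A : G.Fam) : Rel X (symP A * symP A) (symP A)
  | s_partialIsometry (e : G.Edge) : Rel X (symS e * star (symS e) * symS e) (symS e)
  | s_orthogonal (e e' : G.Edge) (h : e ≠ e') : Rel X (star (symS e) * symS e') 0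
  | p_empty : Rel X (symP Fam.empty) 0
  | p_inter (A B : G.Fam) : Rel X (symP A * symP B) (symP (A.inter B))
  | p_union (A B : G.Fam) : Rel X (symP (A.union B)) (symP A + symP B - symP (A.inter B))
  | s_source (e : G.Edge) : Rel X (star (symS e) * symS e) (symP (Fam.range e))
  | s_range (e : G.Edge) :
      Rel X (symP (Fam.vert (G.s e)) * (symS e * star (symS e))) (symS e * star (symS e))
  | cuntzKrieger (a : G.Vert) (ha : a ∈ X) :
      Rel X (symP (Fam.vert a)) (∑ᶠ (e : G.Edge) (_ : G.s e = a), symS e * star (symS e))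

/-- C*-seminorms on the free *-algebra with respect to which the defining relations hold. -/
structure RelSeminorm (X : Set G.Vert) extends Seminorm ℂ G.FreeAlg where
  mul_le' (x y : G.FreeAlg) : toFun (x * y) ≤ toFun x * toFun y
  cstar' (x : G.FreeAlg) : toFun (star x * x) = toFun x * toFun x
  rel' (x y : G.FreeAlg) : Rel X x y → toFun (x - y) = 0

instance (X : Set G.Vert) : Nonempty (RelSeminorm X) :=
  ⟨{ (0 : Seminorm ℂ G.FreeAlg) with
      mul_le' := fun x y => by
        change (0 : ℝ) ≤ 0 * 0
        simp
      cstar' := fun x => by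
        change (0 : ℝ) = 0 * 0
        simp
      rel' := fun x y _ => rfl }⟩

namespace RelSeminorm

variable {X : Set G.Vert} (N : RelSeminorm X)

lemma mul_le (x y : G.FreeAlg) :
    N.toSeminorm (x * y) ≤ N.toSeminorm x * N.toSeminorm y := N.mul_le' x y

lemma cstar (x : G.FreeAlg) :
    N.toSeminorm (star x * x) = N.toSeminorm x * N.toSeminorm x := N.cstar' x

lemma eq_of_rel {x y : G.FreeAlg} (h : Rel X x y) : N.toSeminorm x = N.toSeminorm y := by
  have h0 : N.toSeminorm (x - y) = 0 := N.rel' x y h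
  have h1 := abs_sub_map_le_sub N.toSeminorm x y
  rw [h0] at h1
  exact sub_eq_zero.mp (abs_nonpos_iff.mp h1)

lemma star_eq (x : G.FreeAlg) : N.toSeminorm (star x) = N.toSeminorm x := by
  have key : ∀ y : G.FreeAlg, N.toSeminorm y ≤ N.toSeminorm (star y) := by
    intro y
    have h1 := N.cstar y
    have h2 := N.mul_le (star y) y
    have h3 : 0 ≤ N.toSeminorm y := apply_nonneg _ _
    have h4 : 0 ≤ N.toSeminorm (star y) := apply_nonneg _ _
    by_contra h
    push Not at h
    nlinarith
  apply le_antisymm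
  · simpa using key (star x)
  · exact key x

lemma le_one_of_sq {t : ℝ} (h : t * t = t) : t ≤ 1 := by nlinarith [sq_nonneg (t - 1)]

lemma symP_le (A : G.Fam) : N.toSeminorm (symP A) ≤ 1 := by
  apply le_one_of_sq
  have h1 := N.cstar (symP A)
  have h2 : N.toSeminorm (star (symP A) * symP A) = N.toSeminorm (symP A * symP A) := by
    have h3 : N.toSeminorm (star (symP A) - symP A) = 0 := N.rel' _ _ (.p_selfAdjoint A)
    have h4 := N.mul_le (star (symP A) - symP A) (symP A)
    rw [h3, zero_mul, sub_mul] at h4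
    have h5 := abs_sub_map_le_sub N.toSeminorm (star (symP A) * symP A) (symP A * symP A)
    exact sub_eq_zero.mp (abs_nonpos_iff.mp (h5.trans h4))
  rw [← h1, h2, N.eq_of_rel (.p_idem A)]

lemma symS_le (e : G.Edge) : N.toSeminorm (symS e) ≤ 1 := by
  have h1 := N.cstar (symS e)
  rw [N.eq_of_rel (.s_source e)] at h1
  have h2 := N.symP_le (Fam.range e)
  have h3 : 0 ≤ N.toSeminorm (symS e) := apply_nonneg _ _
  nlinarith

lemma letter_le (l : G.Letter) :
    N.toSeminorm (MonoidAlgebra.single (FreeSemigroup.of l) 1) ≤ 1 := by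
  obtain ⟨l, b⟩ := l
  have key : N.toSeminorm (MonoidAlgebra.single (FreeSemigroup.of (l, false)) 1) ≤ 1 := by
    rcases l with e | A
    · exact N.symS_le e
    · exact N.symP_le A
  cases b with
  | false => exact key
  | true =>
    have h : (MonoidAlgebra.single (FreeSemigroup.of (l, true)) 1 : G.FreeAlg)
        = star (MonoidAlgebra.single (FreeSemigroup.of (l, false)) 1) := by
      rw [star_single, star_one]
      rfl
    rw [h, N.star_eq]
    exact key

lemma word_le (w : FreeSemigroup G.Letter) : N.toSeminorm (MonoidAlgebra.single w 1) ≤ 1 := by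
  induction w using FreeSemigroup.recOnMul with
  | ih1 l => exact N.letter_le l
  | ih2 l w h1 h2 =>
    have h : (MonoidAlgebra.single (FreeSemigroup.of l * w) 1 : G.FreeAlg)
        = MonoidAlgebra.single (FreeSemigroup.of l) 1 * MonoidAlgebra.single w 1 := by
      rw [MonoidAlgebra.single_mul_single, one_mul]
    rw [h]
    exact (N.mul_le _ _).trans (mul_le_one₀ h1 (apply_nonneg _ _) h2)

lemma exists_bound (x : G.FreeAlg) : ∃ C : ℝ, ∀ N : RelSeminorm X, N.toSeminorm x ≤ C := by
  induction x using MonoidAlgebra.induction_linear with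
  | zero => exact ⟨0, fun N => by simp⟩
  | add a b ha hb =>
    obtain ⟨C, hC⟩ := ha
    obtain ⟨D, hD⟩ := hb
    exact ⟨C + D, fun N => (map_add_le_add N.toSeminorm a b).trans (add_le_add (hC N) (hD N))⟩
  | single w c =>
    refine ⟨‖c‖, fun N => ?_⟩
    have h : (MonoidAlgebra.single w c : G.FreeAlg) = c • MonoidAlgebra.single w 1 := by
      rw [MonoidAlgebra.smul_single, smul_eq_mul, mul_one]
    rw [h, map_smul_eq_mul]
    exact mul_le_of_le_one_right (norm_nonneg _) (N.word_le w)

lemma bddAbove (x : G.FreeAlg) :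
    BddAbove (Set.range fun N : RelSeminorm X => N.toSeminorm x) := by
  obtain ⟨C, hC⟩ := exists_bound (X := X) x
  exact ⟨C, by rintro _ ⟨N, rfl⟩; exact hC N⟩

end RelSeminorm

variable (X : Set G.Vert)

/-- The universal C*-seminorm: the supremum of all C*-seminorms that respect the relations. -/
def univNorm (x : G.FreeAlg) : ℝ := ⨆ N : RelSeminorm X, N.toSeminorm x

variable {X} in
lemma le_univNorm (N : RelSeminorm X) (x : G.FreeAlg) : N.toSeminorm x ≤ univNorm X x :=
  le_ciSup (RelSeminorm.bddAbove x) N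

variable {X} in
lemma univNorm_nonneg (x : G.FreeAlg) : 0 ≤ univNorm X x :=
  Real.iSup_nonneg fun N => apply_nonneg N.toSeminorm x

lemma univNorm_mul (x y : G.FreeAlg) : univNorm X (x * y) ≤ univNorm X x * univNorm X y :=
  ciSup_le fun N => (N.mul_le x y).trans
    (mul_le_mul (le_univNorm N x) (le_univNorm N y) (apply_nonneg _ _) (univNorm_nonneg x))

lemma univNorm_cstar (x : G.FreeAlg) :
    univNorm X x * univNorm X x ≤ univNorm X (star x * x) := by
  have h : univNorm X x ≤ Real.sqrt (univNorm X (star x * x)) := by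
    refine ciSup_le fun N => Real.le_sqrt_of_sq_le ?_
    rw [sq, ← N.cstar]
    exact le_univNorm N _
  calc univNorm X x * univNorm X x
      ≤ Real.sqrt (univNorm X (star x * x)) * Real.sqrt (univNorm X (star x * x)) :=
        mul_self_le_mul_self (univNorm_nonneg x) h
    _ = _ := Real.mul_self_sqrt (univNorm_nonneg _)

lemma univNorm_star (x : G.FreeAlg) : univNorm X (star x) = univNorm X x := by
  simp only [univNorm, RelSeminorm.star_eq]

lemma univNorm_smul_le (c : ℂ) (x : G.FreeAlg) : univNorm X (c • x) ≤ ‖c‖ * univNorm X x :=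
  ciSup_le fun N => by
    rw [map_smul_eq_mul]
    exact mul_le_mul_of_nonneg_left (le_univNorm N x) (norm_nonneg _)

variable (G) in
/-- The free *-algebra, seminormed by the universal C*-seminorm. -/
def PreAlg (X : Set G.Vert) : Type (max u v) := (fun _ => G.FreeAlg) X

namespace PreAlg

instance : NonUnitalRing (G.PreAlg X) := inferInstanceAs (NonUnitalRing G.FreeAlg)
instance : Module ℂ (G.PreAlg X) := inferInstanceAs (Module ℂ G.FreeAlg)
instance : IsScalarTower ℂ (G.PreAlg X) (G.PreAlg X) :=
  inferInstanceAs (IsScalarTower ℂ G.FreeAlg G.FreeAlg)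
instance : SMulCommClass ℂ (G.PreAlg X) (G.PreAlg X) :=
  inferInstanceAs (SMulCommClass ℂ G.FreeAlg G.FreeAlg)
instance : StarRing (G.PreAlg X) := inferInstanceAs (StarRing G.FreeAlg)
instance : StarModule ℂ (G.PreAlg X) := inferInstanceAs (StarModule ℂ G.FreeAlg)

def groupSeminorm : AddGroupSeminorm (G.PreAlg X) where
  toFun := univNorm X
  map_zero' := by
    change univNorm X (0 : G.FreeAlg) = 0
    simp [univNorm]
  add_le' x y := ciSup_le fun N =>
    (map_add_le_add N.toSeminorm _ _).trans (add_le_add (le_univNorm N x) (le_univNorm N y))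
  neg' x := by
    change univNorm X (-(show G.FreeAlg from x)) = univNorm X x
    unfold univNorm
    exact iSup_congr fun N => map_neg_eq_map N.toSeminorm (show G.FreeAlg from x)

instance : SeminormedAddCommGroup (G.PreAlg X) :=
  (groupSeminorm X).toSeminormedAddCommGroup

instance : NonUnitalSeminormedRing (G.PreAlg X) where
  __ := (inferInstance : SeminormedAddCommGroup (G.PreAlg X))
  __ := (inferInstance : NonUnitalRing (G.PreAlg X))
  norm_mul_le := univNorm_mul X

instance : NormedSpace ℂ (G.PreAlg X) where
  norm_smul_le := univNorm_smul_le X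

instance : SeminormedCStar (G.PreAlg X) where
  norm_star_le x := (univNorm_star X x).le
  norm_mul_self_le x := univNorm_cstar X x

/-- The identity map of the free *-algebra, to its seminormed copy. -/
def mk : G.FreeAlg ≃ₗ[ℂ] G.PreAlg X := LinearEquiv.refl ℂ G.FreeAlg

end PreAlg

variable (G) in
/-- The relative ultragraph C*-algebra `C*(G, X)`: the universal C*-algebra of the relations, that
is, the Hausdorff completion of the free *-algebra in the universal C*-seminorm. -/
def Alg (X : Set G.Vert) : Type (max u v) := CStarCompletion (G.PreAlg X)

namespace Alg

instance : NonUnitalCStarAlgebra (G.Alg X) :=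
  inferInstanceAs (NonUnitalCStarAlgebra (CStarCompletion (G.PreAlg X)))

/-- The canonical *-homomorphism of the free *-algebra into its completion. -/
def of : G.FreeAlg →⋆ₙₐ[ℂ] G.Alg X where
  toFun a := CStarCompletion.of (G.PreAlg X) (PreAlg.mk X a)
  map_smul' c a := by rw [map_smul, map_smul]; rfl
  map_zero' := by rw [map_zero, map_zero]; rfl
  map_add' a b := by rw [map_add, map_add]; rfl
  map_mul' a b := CStarCompletion.of_mul (PreAlg.mk X a) (PreAlg.mk X b)
  map_star' a := (CStarCompletion.star_of (PreAlg.mk X a)).symm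

/-- The generator `s_e` of `C*(G, X)`. -/
def s (X : Set G.Vert) (e : G.Edge) : G.Alg X := of X (symS e)

/-- The generator `p_A` of `C*(G, X)`. -/
def p (X : Set G.Vert) (A : G.Fam) : G.Alg X := of X (symP A)

/-- The element `q_a = p_a - ∑_{s(e) = a} s_e s_e^*`. -/
def q (X : Set G.Vert) (a : G.Vert) : G.Alg X :=
  p X (Fam.vert a) - ∑ᶠ (e : G.Edge) (_ : G.s e = a), s X e * star (s X e)

end Alg

/-- The equations that determine the isomorphism `ψ : C*(G_X) → C*(G, X)` on generators. All sums
are finite when every `r(e) ∩ Y` is finite. -/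
structure IsPsi {X : Set G.Vert} (hfin : ∀ e, (G.r e ∩ G.Y X).Finite)
    (ψ : (G.ext X).Alg (G.ext X).Reg → G.Alg X) : Prop where
  map_p (Z : (G.ext X).Fam) :
    ψ (Alg.p _ Z) = Alg.p X Z.base - Alg.p X (Z.base.interY hfin)
      + (∑ᶠ (g : G.Edge) (_ : G.s g ∈ Z.base.1 ∩ G.Y X), Alg.s X g * star (Alg.s X g))
      + ∑ᶠ (a : G.Vert) (_ : a ∈ Z.top), Alg.q X a
  map_s (e : G.Edge) :
    ψ (Alg.s _ (Sum.inl e : (G.ext X).Edge)) = Alg.s X e *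
      (Alg.p X (Fam.range e) - Alg.p X ((Fam.range e).interY hfin)
        + ∑ᶠ (g : G.Edge) (_ : G.s g ∈ G.r e ∩ G.Y X), Alg.s X g * star (Alg.s X g))
  map_s' (e : {e : G.Edge // (G.r e ∩ G.Y X).Nonempty}) :
    ψ (Alg.s _ (Sum.inr e : (G.ext X).Edge)) = Alg.s X e.1 *
      (Alg.p X ((Fam.range e.1).interY hfin)
        - ∑ᶠ (g : G.Edge) (_ : G.s g ∈ G.r e.1 ∩ G.Y X), Alg.s X g * star (Alg.s X g))

end Algebra

/-! ### Branching systems -/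

section Branching

variable (G : Ultragraph.{u, v}) (𝒳 : Type w)

/-- The data of a branching system on `𝒳`: sets `R_e`, `D_A`, maps `f_e : D_{r(e)} → R_e` and
`f_e⁻¹ : R_e → D_{r(e)}`, and densities `Φ_{f_e}`, `Φ_{f_e⁻¹}`. Maps and densities are recorded as
functions on all of `𝒳`; only their values on their domains `D_{r(e)}` and `R_e` matter. -/
structure BranchingData where
  R : G.Edge → Set 𝒳
  D : G.Fam → Set 𝒳
  f : G.Edge → 𝒳 → 𝒳
  finv : G.Edge → 𝒳 → 𝒳
  Φ : G.Edge → 𝒳 → ℝ≥0∞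
  Φinv : G.Edge → 𝒳 → ℝ≥0∞

variable {G 𝒳}

namespace BranchingData

/-- The image `f_e(S)`, formed through the inverse as `{y ∈ R_e | f_e⁻¹(y) ∈ S}`. For `S` contained
in `D_{r(e)}` and `f_e`, `f_e⁻¹` mutually inverse this is the set of values `f_e '' S`
(`img_eq_image`); when they are mutually inverse almost everywhere it is the measurable version of
that set. -/
def img (S : BranchingData G 𝒳) (e : G.Edge) (T : Set 𝒳) : Set 𝒳 := S.R e ∩ S.finv e ⁻¹' T

lemma img_eq_image (S : BranchingData G 𝒳) (e : G.Edge) {T : Set 𝒳}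
    (hT : T ⊆ S.D (Fam.range e)) (hf : MapsTo (S.f e) (S.D (Fam.range e)) (S.R e))
    (hinv : InvOn (S.finv e) (S.f e) (S.D (Fam.range e)) (S.R e)) :
    S.img e T = S.f e '' T := by
  ext y
  constructor
  · rintro ⟨hy, hyT⟩
    exact ⟨S.finv e y, hyT, hinv.2 hy⟩
  · rintro ⟨x, hx, rfl⟩
    refine ⟨hf (hT hx), ?_⟩
    change S.finv e (S.f e x) ∈ T
    rwa [hinv.1 (hT hx)]

variable [MeasurableSpace 𝒳]

/-- Relative `(G, X)`-branching systems. For `X = Reg(G)` these are the `G`-branching systems.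
The measure `μ ∘ f_e` on `D_{r(e)}`, `E ↦ μ (f_e(E))`, is the image under `f_e⁻¹` of `μ` on `R_e`,
and `μ ∘ f_e⁻¹` on `R_e` is the image under `f_e` of `μ` on `D_{r(e)}`; the last two fields say that
they are absolutely continuous with respect to `μ` with Radon-Nikodym derivatives `Φ_{f_e}` and
`Φ_{f_e⁻¹}`. -/
structure IsRelBranchingSystem (S : BranchingData G 𝒳) (X : Set G.Vert) (μ : Measure 𝒳) :
    Prop where
  measurableSet_R (e : G.Edge) : MeasurableSet (S.R e)
  measurableSet_D (A : G.Fam) : MeasurableSet (S.D A)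
  R_disjoint (e e' : G.Edge) : e ≠ e' → (S.R e ∩ S.R e' : Set 𝒳) =ᵐ[μ] (∅ : Set 𝒳)
  D_empty : S.D Fam.empty = ∅
  D_inter (A B : G.Fam) : (S.D A ∩ S.D B : Set 𝒳) =ᵐ[μ] S.D (A.inter B)
  D_union (A B : G.Fam) : (S.D A ∪ S.D B : Set 𝒳) =ᵐ[μ] S.D (A.union B)
  R_subset (e : G.Edge) : S.R e ≤ᵐ[μ] S.D (Fam.vert (G.s e))
  D_vert (a : G.Vert) : a ∈ X → S.D (Fam.vert a) =ᵐ[μ] (⋃ (e : G.Edge) (_ : G.s e = a), S.R e)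
  measurable_f (e : G.Edge) : Measurable (S.f e)
  measurable_finv (e : G.Edge) : Measurable (S.finv e)
  f_mem (e : G.Edge) : ∀ᵐ x ∂μ, x ∈ S.D (Fam.range e) → S.f e x ∈ S.R e
  finv_mem (e : G.Edge) : ∀ᵐ y ∂μ, y ∈ S.R e → S.finv e y ∈ S.D (Fam.range e)
  f_finv (e : G.Edge) : ∀ᵐ y ∂μ, y ∈ S.R e → S.f e (S.finv e y) = y
  finv_f (e : G.Edge) : ∀ᵐ x ∂μ, x ∈ S.D (Fam.range e) → S.finv e (S.f e x) = x
  measurable_Φ (e : G.Edge) : Measurable (S.Φ e)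
  measurable_Φinv (e : G.Edge) : Measurable (S.Φinv e)
  rnDeriv_f (e : G.Edge) : (μ.restrict (S.R e)).map (S.finv e) =
    (μ.restrict (S.D (Fam.range e))).withDensity (S.Φ e)
  rnDeriv_finv (e : G.Edge) : (μ.restrict (S.D (Fam.range e))).map (S.f e) =
    (μ.restrict (S.R e)).withDensity (S.Φinv e)

/-- `η` is a representation of `C*(G, X)` on `L²(μ)` induced by the system:
`η(s_e) φ = Φ_{f_e⁻¹}^{1/2} (φ ∘ f_e⁻¹) χ_{R_e}` and `η(p_A) φ = χ_{D_A} φ`. -/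
structure Induces (S : BranchingData G 𝒳) (X : Set G.Vert) (μ : Measure 𝒳)
    (η : G.Alg X →⋆ₙₐ[ℂ] (Lp ℂ 2 μ →L[ℂ] Lp ℂ 2 μ)) : Prop where
  map_s (e : G.Edge) (φ : Lp ℂ 2 μ) :
    (η (Alg.s X e) φ : 𝒳 → ℂ) =ᵐ[μ] (S.R e).indicator
      (fun x => ((Real.sqrt (S.Φinv e x).toReal : ℝ) : ℂ) * φ (S.finv e x))
  map_p (A : G.Fam) (φ : Lp ℂ 2 μ) :
    (η (Alg.p X A) φ : 𝒳 → ℂ) =ᵐ[μ] (S.D A).indicator φ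

/-- `D_v \ ⋃_{s(g) = v} R_g`. -/
def defect (S : BranchingData G 𝒳) (a : G.Vert) : Set 𝒳 :=
  S.D (Fam.vert a) \ ⋃ (g : G.Edge) (_ : G.s g = a), S.R g

/-- The system `{Q_f, B_Z, g_f}` for `G_X` constructed from a relative `(G, X)`-system
`{R_e, D_A, f_e}`. The maps `g_e` and `g_{e'}` are the restrictions of `f_e`. -/
def lift (S : BranchingData G 𝒳) {X : Set G.Vert} (hfin : ∀ e, (G.r e ∩ G.Y X).Finite) :
    BranchingData (G.ext X) 𝒳 where
  D Z := (S.D Z.base \ S.D (Z.base.interY hfin)) ∪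
    (⋃ (g : G.Edge) (_ : G.s g ∈ Z.base.1 ∩ G.Y X), S.R g) ∪
    (⋃ (a : G.Vert) (_ : a ∈ Z.top), S.defect a)
  R := Sum.elim
    (fun e => (S.img e (S.D (Fam.range e)) \ S.img e (S.D ((Fam.range e).interY hfin))) ∪
      S.img e (⋃ (g : G.Edge) (_ : G.s g ∈ G.r e ∩ G.Y X), S.R g))
    (fun e => S.img e.1 (⋃ (a : G.Vert) (_ : a ∈ G.r e.1 ∩ G.Y X), S.defect a))
  f := Sum.elim S.f (fun e => S.f e.1)
  finv := Sum.elim S.finv (fun e => S.finv e.1)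
  Φ := Sum.elim S.Φ (fun e => S.Φ e.1)
  Φinv := Sum.elim S.Φinv (fun e => S.Φinv e.1)

end BranchingData

end Branching

end Ultragraph

end

/-!
The isomorphism `C*(G_X) ≅ C*(G, X)` rests on the projections `q_a = p_a - ∑_{s(e) = a} s_e s_e^*`
(`gap`), `a ∈ Y`. They are mutually orthogonal, satisfy `p_A q_a = q_a` or `0` according to whether
`a ∈ A`, and annihilate every `s_e`. Subtracting `q_a` from `p_a` therefore forces the
Cuntz-Krieger relation at `a`, and the new vertex `a'` takes up what has been cut off. So every
family that satisfies the relations of `C*(G, X)` yields one for `G_X` (`IsFamily.extend`):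
`P_Z = p_A - ∑_{a ∈ A ∩ Y} q_a + ∑_{a ∈ T} q_a` for `Z = A ∪ T'`, and `S_f = s_e P_{r(f)}` for both
edges `f = e, e'` that arise from `e`. Conversely `p_A = P_{A ∪ (A ∩ Y)'}` and `s_e = S_e + S_{e'}`
turn a family for `G_X` into one for `G` relative to `X` (`IsFamily.restrict`), and the two
constructions are mutually inverse (`exists_iso`).

A branching system acts on `L²(μ)` by indicator functions and by weighted composition operators
`T_e φ = Φ_{f_e⁻¹}^{1/2} (φ ∘ f_e⁻¹) χ_{R_e}`. The change of variables formula shows that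
`‖T_e φ‖ = ‖χ_{D_{r(e)}} φ‖`, so that `T_e^* T_e = χ_{D_{r(e)}}`, and that every `ψ ∈ L²(R_e)` is a
value of `T_e`, so that `T_e T_e^* = χ_{R_e}` (`edgeOp_mul_star`). The measure is arbitrary: the
densities may be infinite, and they need only be reciprocal on the supports of integrable functions
(`Φinv_mul_Φ_eq_one`), which is all that enters. Hence the operators satisfy the relations, and the
universal property gives the representation.

That the lifted system is a branching system is checked point by point outside a null set, where all
of the countably many relations between the sets of the system hold at once (`IsGeneric`). Such a
point lies in no `D_a` with `a ∈ Y`, or in `R_g` for a unique `g` with `s(g) ∈ Y`, or in `D_a` for a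
unique `a ∈ Y` but in no `R_g`; it then belongs to `B_Z`, `Z = A ∪ T'`, if and only if it belongs to
`D_A`, or `s(g) ∈ A`, or `a ∈ T`, respectively. Finally `π = η ∘ ψ` is equivalent to
`π ∘ ψ⁻¹ = η`. By uniqueness this only requires that `π ∘ ψ⁻¹` is induced by the given system, that
is, `D_A = B_{A ∪ (A ∩ Y)'}` and `R_e = Q_e ∪ Q_{e'}` up to null sets (`induces_comp`).
-/

/-! ### The universal property -/

namespace Ultragraph

variable {G : Ultragraph.{u, v}}

/-- A family of elements `S e`, `P A` of a C*-algebra that satisfies the defining relations of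
`C*(G, X)`. -/
structure IsFamily (X : Set G.Vert) {B : Type*} [NonUnitalCStarAlgebra B]
    (S : G.Edge → B) (P : G.Fam → B) : Prop where
  p_star (A : G.Fam) : star (P A) = P A
  p_inter (A A' : G.Fam) : P A * P A' = P (A.inter A')
  p_empty : P Fam.empty = 0
  p_union (A A' : G.Fam) : P (A.union A') = P A + P A' - P (A.inter A')
  s_orthogonal (e e' : G.Edge) : e ≠ e' → star (S e) * S e' = 0
  s_source (e : G.Edge) : star (S e) * S e = P (Fam.range e)
  mul_range (e : G.Edge) : S e * P (Fam.range e) = S e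
  source_mul (e : G.Edge) : P (Fam.vert (G.s e)) * S e = S e
  cuntzKrieger (a : G.Vert) (ha : a ∈ X) :
    P (Fam.vert a) = ∑ᶠ (e : G.Edge) (_ : G.s e = a), S e * star (S e)

lemma Fam.inter_self (A : G.Fam) : A.inter A = A := Subtype.ext (Set.inter_self _)

lemma Fam.inter_comm (A B : G.Fam) : A.inter B = B.inter A := Subtype.ext (Set.inter_comm _ _)

section Lift

variable {B : Type*} [NonUnitalCStarAlgebra B]

/-- The value of a letter under an assignment of the generators. -/
def letterVal (S : G.Edge → B) (P : G.Fam → B) (l : G.Letter) : B :=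
  bif l.2 then star (Sum.elim S P l.1) else Sum.elim S P l.1

/-- The *-homomorphism of the free *-algebra that extends an assignment of the generators. -/
noncomputable def freeLift (S : G.Edge → B) (P : G.Fam → B) : G.FreeAlg →⋆ₙₐ[ℂ] B :=
  { MonoidAlgebra.liftMagma ℂ (FreeSemigroup.lift (letterVal S P)) with
    map_star' := fun x => by
      change MonoidAlgebra.liftMagma ℂ (FreeSemigroup.lift (letterVal S P)) (star x)
        = star (MonoidAlgebra.liftMagma ℂ (FreeSemigroup.lift (letterVal S P)) x)
      induction x using MonoidAlgebra.induction_linear with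
      | zero => simp
      | add a b ha hb => rw [star_add, map_add, map_add, ha, hb, star_add]
      | single w c =>
        have h : FreeSemigroup.lift (letterVal S P) (star w)
            = star (FreeSemigroup.lift (letterVal S P) w) := by
          induction w using FreeSemigroup.recOnMul with
          | ih1 l =>
            obtain ⟨l, b⟩ := l
            change FreeSemigroup.lift (letterVal S P) (FreeSemigroup.of (l, !b)) = _
            cases b <;> simp [letterVal]
          | ih2 l w h1 h2 => rw [star_mul, map_mul, h1, h2, map_mul, star_mul]
        rw [star_single, MonoidAlgebra.liftMagma_apply_apply, MonoidAlgebra.liftMagma_apply_apply]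
        simp [h] }

lemma freeLift_symS (S : G.Edge → B) (P : G.Fam → B) (e : G.Edge) :
    freeLift S P (symS e) = S e := by
  change MonoidAlgebra.liftMagma ℂ (FreeSemigroup.lift (letterVal S P)) (symS e) = _
  rw [MonoidAlgebra.liftMagma_apply_apply]
  simp [symS, letterVal]

lemma freeLift_symP (S : G.Edge → B) (P : G.Fam → B) (A : G.Fam) :
    freeLift S P (symP A) = P A := by
  change MonoidAlgebra.liftMagma ℂ (FreeSemigroup.lift (letterVal S P)) (symP A) = _
  rw [MonoidAlgebra.liftMagma_apply_apply]
  simp [symP, letterVal]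

/-- The sums in the Cuntz-Krieger relations are finite, so additive maps pass through them. -/
lemma map_finsum_source {M N : Type*} [AddCommMonoid M] [AddCommMonoid N] (F : M →+ N)
    {a : G.Vert} (ha : a ∈ G.Reg) (f : G.Edge → M) :
    F (∑ᶠ (e : G.Edge) (_ : G.s e = a), f e) = ∑ᶠ (e : G.Edge) (_ : G.s e = a), F (f e) :=
  F.map_finsum_mem f ha.2

variable {X : Set G.Vert}

lemma IsFamily.freeLift_eq_of_rel {S : G.Edge → B} {P : G.Fam → B} (h : IsFamily X S P)
    (hX : X ⊆ G.Reg) {x y : G.FreeAlg} (hxy : Rel X x y) : freeLift S P x = freeLift S P y := by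
  cases hxy with
  | cuntzKrieger a ha =>
    rw [freeLift_symP, h.cuntzKrieger a ha]
    refine Eq.symm ((map_finsum_source (freeLift S P : G.FreeAlg →+ B) (hX ha) _).trans ?_)
    simp [freeLift_symS, map_star]
  | s_range e =>
    simp only [map_mul, map_star, freeLift_symS, freeLift_symP, ← mul_assoc, h.source_mul]
  | s_partialIsometry e =>
    simp only [map_mul, map_star, freeLift_symS, mul_assoc, h.s_source, h.mul_range]
  | _ =>
    simp_all [map_mul, map_star, map_add, map_sub, freeLift_symS, freeLift_symP, h.p_star,
      h.p_inter, h.p_empty, h.p_union, h.s_source, Fam.inter_self, h.s_orthogonal]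

lemma IsFamily.norm_freeLift_le {S : G.Edge → B} {P : G.Fam → B} (h : IsFamily X S P)
    (hX : X ⊆ G.Reg) (x : G.FreeAlg) : ‖freeLift S P x‖ ≤ univNorm X x :=
  le_univNorm (X := X)
    { (normSeminorm ℂ B).comp (freeLift S P : G.FreeAlg →ₗ[ℂ] B) with
      mul_le' := fun x y => by
        change ‖freeLift S P (x * y)‖ ≤ ‖freeLift S P x‖ * ‖freeLift S P y‖
        rw [map_mul]
        exact norm_mul_le _ _
      cstar' := fun x => by
        change ‖freeLift S P (star x * x)‖ = ‖freeLift S P x‖ * ‖freeLift S P x‖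
        rw [map_mul, map_star]
        exact CStarRing.norm_star_mul_self
      rel' := fun x y hxy => by
        change ‖freeLift S P (x - y)‖ = 0
        rw [map_sub, h.freeLift_eq_of_rel hX hxy, sub_self, norm_zero] } x

end Lift

namespace Alg

variable {X : Set G.Vert}

lemma ind {p : G.Alg X → Prop} (hp : IsClosed {x | p x}) (h : ∀ a, p (of X a)) (x : G.Alg X) :
    p x := CStarCompletion.ind₁ (A := G.PreAlg X) hp h x

lemma ind₂ {p : G.Alg X → G.Alg X → Prop} (hp : IsClosed {x : G.Alg X × G.Alg X | p x.1 x.2})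
    (h : ∀ a b, p (of X a) (of X b)) (x y : G.Alg X) : p x y :=
  CStarCompletion.ind₂ (A := G.PreAlg X) hp h x y

lemma norm_of (a : G.FreeAlg) : ‖of X a‖ = univNorm X a :=
  CStarCompletion.norm_of (A := G.PreAlg X) a

lemma of_star (a : G.FreeAlg) : of X (star a) = star (of X a) := map_star (of X) a

lemma of_eq_of_rel {x y : G.FreeAlg} (h : Rel X x y) : of X x = of X y := by
  rw [← sub_eq_zero, ← map_sub, ← norm_eq_zero, norm_of]
  have h0 (N : RelSeminorm X) : N.toSeminorm (x - y) = 0 := N.rel' x y h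
  simp [univNorm, h0]

/-- The generators of `C*(G, X)` satisfy its defining relations. -/
lemma isFamily (hX : X ⊆ G.Reg) : IsFamily X (s X) (p X) where
  p_star A := by simpa [p, of_star] using of_eq_of_rel (.p_selfAdjoint (X := X) A)
  p_inter A A' := by simpa [p, of_star] using of_eq_of_rel (.p_inter (X := X) A A')
  p_empty := by simpa [p, of_star] using of_eq_of_rel (.p_empty (X := X))
  p_union A A' := by simpa [p, of_star] using of_eq_of_rel (.p_union (X := X) A A')
  s_orthogonal e e' h := by simpa [s, of_star] using of_eq_of_rel (.s_orthogonal (X := X) e e' h)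
  s_source e := by simpa [s, p, of_star] using of_eq_of_rel (.s_source (X := X) e)
  mul_range e := by
    have h1 : star (s X e) * s X e = p X (Fam.range e) := by
      simpa [s, p, of_star] using of_eq_of_rel (.s_source (X := X) e)
    have h2 : s X e * star (s X e) * s X e = s X e := by
      simpa [s, of_star] using of_eq_of_rel (.s_partialIsometry (X := X) e)
    rw [← h1, ← mul_assoc, h2]
  source_mul e := by
    have h1 : p X (Fam.vert (G.s e)) * (s X e * star (s X e)) = s X e * star (s X e) := by
      simpa [s, p, of_star] using of_eq_of_rel (.s_range (X := X) e)
    have h2 : s X e * star (s X e) * s X e = s X e := by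
      simpa [s, of_star] using of_eq_of_rel (.s_partialIsometry (X := X) e)
    calc p X (Fam.vert (G.s e)) * s X e
        = p X (Fam.vert (G.s e)) * (s X e * star (s X e)) * s X e := by
          rw [mul_assoc, h2]
      _ = s X e := by rw [h1, h2]
  cuntzKrieger a ha := by
    refine (of_eq_of_rel (.cuntzKrieger (X := X) a ha)).trans
      ((map_finsum_source (of X : G.FreeAlg →+ G.Alg X) (hX ha) _).trans ?_)
    simp [s, of_star]

variable {B : Type*} [NonUnitalCStarAlgebra B]

lemma hom_ext {φ ψ : G.Alg X →⋆ₙₐ[ℂ] B} (hs : ∀ e, φ (s X e) = ψ (s X e))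
    (hp : ∀ A, φ (p X A) = ψ (p X A)) : φ = ψ := by
  have hc (φ : G.Alg X →⋆ₙₐ[ℂ] B) : Continuous φ :=
    AddMonoidHomClass.continuous_of_bound φ 1 fun x => by
      rw [one_mul]
      exact NonUnitalStarAlgHom.norm_apply_le φ x
  ext x
  refine ind (p := fun x => φ x = ψ x) (isClosed_eq (hc φ) (hc ψ))
    (fun a => ?_) x
  induction a using MonoidAlgebra.induction_linear with
  | zero => simp
  | add a b ha hb => simp only [map_add, ha, hb]
  | single w c =>
    have hw : φ (of X (MonoidAlgebra.single w 1)) = ψ (of X (MonoidAlgebra.single w 1)) := by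
      induction w using FreeSemigroup.recOnMul with
      | ih1 l =>
        obtain ⟨l, b⟩ := l
        have key : φ (of X (MonoidAlgebra.single (FreeSemigroup.of (l, false)) 1))
            = ψ (of X (MonoidAlgebra.single (FreeSemigroup.of (l, false)) 1)) := by
          rcases l with e | A
          · exact hs e
          · exact hp A
        cases b with
        | false => exact key
        | true =>
          have h : (MonoidAlgebra.single (FreeSemigroup.of (l, true)) 1 : G.FreeAlg)
              = star (MonoidAlgebra.single (FreeSemigroup.of (l, false)) 1) := by
            rw [star_single, star_one]
            rfl
          rw [h, map_star, map_star, map_star, key]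
      | ih2 l w h1 h2 =>
        have h : (MonoidAlgebra.single (FreeSemigroup.of l * w) 1 : G.FreeAlg)
            = MonoidAlgebra.single (FreeSemigroup.of l) 1 * MonoidAlgebra.single w 1 := by
          rw [MonoidAlgebra.single_mul_single, one_mul]
        rw [h, map_mul, map_mul, map_mul, h1, h2]
    have h : (MonoidAlgebra.single w c : G.FreeAlg) = c • MonoidAlgebra.single w 1 := by
      rw [MonoidAlgebra.smul_single, smul_eq_mul, mul_one]
    rw [h, map_smul, map_smul, map_smul, hw]

/-- The universal property of `C*(G, X)`. -/
lemma exists_lift (hX : X ⊆ G.Reg) {S : G.Edge → B} {P : G.Fam → B} (h : IsFamily X S P) :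
    ∃ φ : G.Alg X →⋆ₙₐ[ℂ] B, (∀ e, φ (s X e) = S e) ∧ ∀ A, φ (p X A) = P A := by
  let f : G.PreAlg X → B := fun x => freeLift S P x
  have hf : UniformContinuous f := by
    let g : G.PreAlg X →+ B := (freeLift S P : G.FreeAlg →+ B)
    exact (AddMonoidHomClass.lipschitz_of_bound g 1 fun x => by
      rw [one_mul]; exact h.norm_freeLift_le hX x).uniformContinuous
  let F : G.Alg X → B := UniformSpace.Completion.extension f
  have hF : Continuous F := UniformSpace.Completion.continuous_extension
  have hFof (a : G.FreeAlg) : F (of X a) = freeLift S P a :=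
    UniformSpace.Completion.extension_coe hf a
  refine ⟨{ toFun := F, map_smul' := fun c x => ?_, map_zero' := ?_, map_add' := fun x y => ?_,
            map_mul' := fun x y => ?_, map_star' := fun x => ?_ }, fun e => ?_, fun A => ?_⟩
  · refine ind (p := fun x => F (c • x) = c • F x)
      (isClosed_eq (hF.comp (continuous_const_smul c)) (hF.const_smul c)) (fun a => ?_) x
    rw [← map_smul, hFof, hFof, map_smul]
  · rw [← map_zero (of X), hFof, map_zero]
  · refine ind₂ (p := fun x y => F (x + y) = F x + F y)
      (isClosed_eq (by fun_prop) (by fun_prop)) (fun a b => ?_) x y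
    rw [← map_add, hFof, hFof, hFof, map_add]
  · refine ind₂ (p := fun x y => F (x * y) = F x * F y)
      (isClosed_eq (by fun_prop) (by fun_prop)) (fun a b => ?_) x y
    rw [← map_mul, hFof, hFof, hFof, map_mul]
  · refine ind (p := fun x => F (star x) = star (F x))
      (isClosed_eq (by fun_prop) (by fun_prop)) (fun a => ?_) x
    rw [← map_star, hFof, hFof, map_star]
  · exact (hFof _).trans (freeLift_symS S P e)
  · exact (hFof _).trans (freeLift_symP S P A)

end Alg

end Ultragraph

/-! ### The gap projections -/

namespace Ultragraph

lemma finsum_mem_ite {α M : Type*} [AddCommMonoid M] (F A : Set α) [DecidablePred (· ∈ A)]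
    (f : α → M) :
    ∑ᶠ a ∈ F, (if a ∈ A then f a else 0) = ∑ᶠ a ∈ A ∩ F, f a :=
  finsum_congr fun a => by by_cases h : a ∈ A <;> by_cases h' : a ∈ F <;> simp [h, h']

lemma finsum_mem_sum {α β M : Type*} [AddCommMonoid M] (F : α ⊕ β → M) {T : Set (α ⊕ β)}
    {T₁ : Set α} {T₂ : Set β} (hT₁ : T₁.Finite) (hT₂ : T₂.Finite)
    (h₁ : ∀ a, Sum.inl a ∈ T ↔ a ∈ T₁) (h₂ : ∀ b, Sum.inr b ∈ T ↔ b ∈ T₂) :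
    ∑ᶠ z ∈ T, F z = ∑ᶠ a ∈ T₁, F (Sum.inl a) + ∑ᶠ b ∈ T₂, F (Sum.inr b) := by
  have hT : T = Sum.inl '' T₁ ∪ Sum.inr '' T₂ := by
    ext z
    rcases z with a | b <;> simp [h₁, h₂]
  rw [← finsum_mem_image Sum.inl_injective.injOn, ← finsum_mem_image Sum.inr_injective.injOn,
    ← finsum_mem_union ?_ (hT₁.image _) (hT₂.image _), hT]
  exact Set.disjoint_left.mpr fun f => by rintro ⟨e, -, rfl⟩ ⟨e', -, h⟩; cases h

lemma finsum_mem_union_eq {α M : Type*} [AddCommGroup M] {F F' : Set α} (hF : F.Finite)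
    (hF' : F'.Finite) (f : α → M) :
    ∑ᶠ a ∈ F ∪ F', f a = ∑ᶠ a ∈ F, f a + ∑ᶠ a ∈ F', f a - ∑ᶠ a ∈ F ∩ F', f a :=
  eq_sub_of_add_eq (finsum_mem_union_inter hF hF')

variable {G : Ultragraph.{u, v}} {B : Type*} [NonUnitalCStarAlgebra B]

/-- The element `∑_{s(e) = a} S_e S_e^*`. -/
noncomputable def outSum (S : G.Edge → B) (a : G.Vert) : B :=
  ∑ᶠ (e : G.Edge) (_ : G.s e = a), S e * star (S e)

/-- The element `P_a - ∑_{s(e) = a} S_e S_e^*`. -/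
noncomputable def gap (S : G.Edge → B) (P : G.Fam → B) (a : G.Vert) : B :=
  P (Fam.vert a) - outSum S a

/-- The sum of the gap elements of the vertices of a set, which is finite in all uses. -/
noncomputable def gapSum (S : G.Edge → B) (P : G.Fam → B) (F : Set G.Vert) : B :=
  ∑ᶠ a ∈ F, gap S P a

namespace IsFamily

variable {X : Set G.Vert} {S : G.Edge → B} {P : G.Fam → B} (h : IsFamily X S P)
include h

lemma p_mul_vert (A : G.Fam) (a : G.Vert) [Decidable (a ∈ A.1)] :
    P A * P (Fam.vert a) = if a ∈ A.1 then P (Fam.vert a) else 0 := by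
  rw [h.p_inter]
  split_ifs with ha
  · congr 1
    exact Subtype.ext (Set.inter_eq_right.mpr (Set.singleton_subset_iff.mpr ha))
  · rw [← h.p_empty]
    congr 1
    exact Subtype.ext (Set.inter_singleton_eq_empty.mpr ha)

lemma p_mul_s (A : G.Fam) (e : G.Edge) [Decidable (G.s e ∈ A.1)] :
    P A * S e = if G.s e ∈ A.1 then S e else 0 := by
  rw [← h.source_mul e, ← mul_assoc, h.p_mul_vert]
  split_ifs <;> simp

lemma s_star_mul_self_mul (e : G.Edge) : S e * star (S e) * S e = S e := by
  rw [mul_assoc, h.s_source, h.mul_range]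

lemma p_mul_outSum (A : G.Fam) {a : G.Vert} (ha : a ∈ G.Reg) [Decidable (a ∈ A.1)] :
    P A * outSum S a = if a ∈ A.1 then outSum S a else 0 := by
  classical
  have h1 : P A * outSum S a = ∑ᶠ (e : G.Edge) (_ : G.s e = a), P A * (S e * star (S e)) :=
    map_finsum_source (AddMonoidHom.mulLeft (P A)) ha _
  rw [h1]
  split_ifs with haA
  · refine finsum_congr fun e => finsum_congr_Prop rfl ?_
    rintro rfl
    rw [← mul_assoc, h.p_mul_s, if_pos haA]
  · refine finsum_mem_of_eqOn_zero (s := {e | G.s e = a}) ?_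
    rintro e rfl
    change P A * (S e * star (S e)) = 0
    rw [← mul_assoc, h.p_mul_s, if_neg haA, zero_mul]

omit h in
lemma star_outSum {a : G.Vert} (ha : a ∈ G.Reg) : star (outSum S a) = outSum S a := by
  refine (map_finsum_source (starAddEquiv : B ≃+ B).toAddMonoidHom ha _).trans ?_
  simp [outSum]

lemma outSum_mul_s {a : G.Vert} (ha : a ∈ G.Reg) (e : G.Edge) [Decidable (G.s e = a)] :
    outSum S a * S e = if G.s e = a then S e else 0 := by
  classical
  have h1 : outSum S a * S e
      = ∑ᶠ (e' : G.Edge) (_ : G.s e' = a), S e' * star (S e') * S e :=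
    map_finsum_source (AddMonoidHom.mulRight (S e)) ha _
  have h2 (e' : G.Edge) : S e' * star (S e') * S e = if e' = e then S e else 0 := by
    split_ifs with he
    · rw [he, h.s_star_mul_self_mul]
    · rw [mul_assoc, h.s_orthogonal _ _ he, mul_zero]
  simp only [h1, h2]
  rw [finsum_eq_single _ e (by intro e' he'; simp [he'])]
  by_cases he : G.s e = a <;> simp [he]

lemma star_gap {a : G.Vert} (ha : a ∈ G.Reg) : star (gap S P a) = gap S P a := by
  rw [gap, star_sub, h.p_star, star_outSum ha]

lemma p_mul_gap (A : G.Fam) {a : G.Vert} (ha : a ∈ G.Reg) [Decidable (a ∈ A.1)] :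
    P A * gap S P a = if a ∈ A.1 then gap S P a else 0 := by
  rw [gap, mul_sub, h.p_mul_vert, h.p_mul_outSum A ha]
  split_ifs <;> simp

lemma gap_mul_s {a : G.Vert} (ha : a ∈ G.Reg) (e : G.Edge) : gap S P a * S e = 0 := by
  classical
  rw [gap, sub_mul, h.outSum_mul_s ha, h.p_mul_s]
  simp only [Fam.vert, mem_singleton_iff, sub_self]

lemma gap_mul_gap {a b : G.Vert} (ha : a ∈ G.Reg) (hb : b ∈ G.Reg) [Decidable (b = a)] :
    gap S P a * gap S P b = if b = a then gap S P b else 0 := by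
  classical
  have h1 : gap S P a * outSum S b = 0 := by
    refine (map_finsum_source (AddMonoidHom.mulLeft (gap S P a)) hb _).trans ?_
    simp [← mul_assoc, h.gap_mul_s ha]
  have h2 : outSum S a * gap S P b = 0 := by
    rw [← star_star (outSum S a * gap S P b), star_mul, star_outSum ha, h.star_gap hb]
    have h3 : gap S P b * outSum S a = 0 := by
      refine (map_finsum_source (AddMonoidHom.mulLeft (gap S P b)) ha _).trans ?_
      simp [← mul_assoc, h.gap_mul_s hb]
    rw [h3, star_zero]
  rw [gap, sub_mul, h2, sub_zero, h.p_mul_gap _ hb]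
  simp only [Fam.vert, mem_singleton_iff]

variable {F F' : Set G.Vert}

lemma star_gapSum (hF : F.Finite) (hR : F ⊆ G.Reg) : star (gapSum S P F) = gapSum S P F := by
  refine ((starAddEquiv : B ≃+ B).toAddMonoidHom.map_finsum_mem _ hF).trans ?_
  refine finsum_mem_congr rfl fun a ha => ?_
  exact h.star_gap (hR ha)

lemma p_mul_gapSum (A : G.Fam) (hF : F.Finite) (hR : F ⊆ G.Reg) :
    P A * gapSum S P F = gapSum S P (A.1 ∩ F) := by
  classical
  refine ((AddMonoidHom.mulLeft (P A)).map_finsum_mem _ hF).trans ?_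
  rw [gapSum, ← finsum_mem_ite]
  exact finsum_mem_congr rfl fun a ha => h.p_mul_gap A (hR ha)

lemma gapSum_mul_p (A : G.Fam) (hF : F.Finite) (hR : F ⊆ G.Reg) :
    gapSum S P F * P A = gapSum S P (A.1 ∩ F) := by
  rw [← star_star (gapSum S P F * P A), star_mul, h.p_star, h.star_gapSum hF hR,
    h.p_mul_gapSum A hF hR,
    h.star_gapSum (hF.subset Set.inter_subset_right) (Set.inter_subset_right.trans hR)]

lemma gapSum_mul_s (hF : F.Finite) (hR : F ⊆ G.Reg) (e : G.Edge) : gapSum S P F * S e = 0 := by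
  refine ((AddMonoidHom.mulRight (S e)).map_finsum_mem _ hF).trans ?_
  exact finsum_mem_of_eqOn_zero fun a ha => h.gap_mul_s (hR ha) e

lemma gapSum_mul_gapSum (hF : F.Finite) (hR : F ⊆ G.Reg) (hF' : F'.Finite) (hR' : F' ⊆ G.Reg) :
    gapSum S P F * gapSum S P F' = gapSum S P (F ∩ F') := by
  classical
  have h1 : ∀ b ∈ F', gapSum S P F * gap S P b = if b ∈ F then gap S P b else 0 := by
    intro b hb
    have h2 : gapSum S P F * gap S P b = ∑ᶠ a ∈ F, gap S P a * gap S P b :=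
      (AddMonoidHom.mulRight (gap S P b)).map_finsum_mem _ hF
    have h3 : ∑ᶠ a ∈ F, gap S P a * gap S P b = ∑ᶠ a ∈ F, if a ∈ ({b} : Set _) then
        gap S P b else 0 := by
      refine finsum_mem_congr rfl fun a ha => ?_
      rw [h.gap_mul_gap (hR ha) (hR' hb)]
      simp only [mem_singleton_iff, eq_comm]
    rw [h2, h3, finsum_mem_ite F {b} fun _ => gap S P b]
    split_ifs with hbF
    · rw [Set.inter_eq_left.mpr (Set.singleton_subset_iff.mpr hbF), finsum_mem_singleton]
    · rw [Set.singleton_inter_eq_empty.mpr hbF, finsum_mem_empty]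
  refine ((AddMonoidHom.mulLeft (gapSum S P F)).map_finsum_mem _ hF').trans ?_
  refine Eq.trans ?_ (finsum_mem_ite F' F (gap S P))
  exact finsum_mem_congr rfl h1

omit h in
lemma gapSum_union (hF : F.Finite) (hF' : F'.Finite) :
    gapSum S P (F ∪ F') = gapSum S P F + gapSum S P F' - gapSum S P (F ∩ F') :=
  finsum_mem_union_eq hF hF' _

lemma p_eq_finsum (A : G.Fam) (hA : A.1.Finite) : P A = ∑ᶠ a ∈ A.1, P (Fam.vert a) := by
  obtain ⟨A, hgen⟩ := A
  change A.Finite at hA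
  induction A, hA using Set.Finite.induction_on with
  | empty => exact (show P ⟨∅, hgen⟩ = 0 from h.p_empty).trans finsum_mem_empty.symm
  | @insert a A ha hA ih =>
    have h1 := h.p_union (Fam.vert a) ⟨A, isGen_of_finite hA⟩
    have h2 : (Fam.vert a).inter ⟨A, isGen_of_finite hA⟩ = Fam.empty :=
      Subtype.ext (Set.singleton_inter_eq_empty.mpr ha)
    rw [h2, h.p_empty, sub_zero, ih] at h1
    rw [finsum_mem_insert _ ha hA, ← h1]
    rfl

omit h in
lemma finsum_source_mem (hF : F.Finite) (hR : F ⊆ G.Reg) :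
    ∑ᶠ (g : G.Edge) (_ : G.s g ∈ F), S g * star (S g) = ∑ᶠ a ∈ F, outSum S a := by
  have h1 : {g | G.s g ∈ F} = ⋃ a ∈ F, {g | G.s g = a} := by ext; simp
  change ∑ᶠ g ∈ {g | G.s g ∈ F}, S g * star (S g) = _
  rw [h1, finsum_mem_biUnion ?_ hF fun a ha => (hR ha).2]
  · rfl
  · intro a _ b _ hab
    exact Set.disjoint_left.mpr fun g hg hg' => hab (hg.symm.trans hg')

lemma p_sub_finsum_source (A : G.Fam) (hA : A.1.Finite) (hR : A.1 ⊆ G.Reg) :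
    P A - ∑ᶠ (g : G.Edge) (_ : G.s g ∈ A.1), S g * star (S g) = gapSum S P A.1 := by
  rw [finsum_source_mem hA hR, h.p_eq_finsum A hA, ← finsum_mem_sub_distrib _ _ hA]
  rfl

end IsFamily

section Finiteness

variable {X : Set G.Vert}

lemma Y_subset_Reg : G.Y X ⊆ G.Reg := fun _ h => h.1

lemma Fam.top_subset_Y (Z : (G.ext X).Fam) : Z.top ⊆ G.Y X := fun _ h => h.1

lemma Fam.finite_top (hfin : ∀ e, (G.r e ∩ G.Y X).Finite) (Z : (G.ext X).Fam) :
    Z.top.Finite := by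
  suffices h : ∀ Z : Set (G.ext X).Vert, (G.ext X).IsGen Z →
      (Sum.inr ⁻¹' Z : Set ↥(G.Y X)).Finite by
    refine ((h Z.1 Z.2).image Subtype.val).subset ?_
    rintro a ⟨ha, haZ⟩
    exact ⟨⟨a, ha⟩, haZ, rfl⟩
  intro Z hZ
  induction hZ with
  | empty => exact Set.finite_empty
  | singleton a => exact (Set.finite_singleton a).preimage Sum.inr_injective.injOn
  | range e =>
    rcases e with e | e
    · exact Set.Finite.subset Set.finite_empty fun y hy => by
        obtain ⟨a, _, ha⟩ := hy
        cases ha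
    · refine Set.Finite.subset ((hfin e.1).preimage Subtype.val_injective.injOn) ?_
      rintro y ⟨y', hy', h⟩
      cases h
      exact ⟨hy', y.2⟩
  | union _ _ h1 h2 => exact h1.union h2
  | inter _ _ h1 _ => exact h1.subset Set.inter_subset_left

lemma mem_Reg_ext_inl {a : G.Vert} : (Sum.inl a : (G.ext X).Vert) ∈ (G.ext X).Reg ↔ a ∈ G.Reg := by
  constructor
  · rintro ⟨⟨f, hf⟩, hfin⟩
    refine ⟨?_, ?_⟩
    · rcases f with e | e
      · exact ⟨e, Sum.inl_injective hf⟩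
      · exact ⟨e.1, Sum.inl_injective hf⟩
    · refine (hfin.preimage (f := Sum.inl) Sum.inl_injective.injOn).subset fun e he => ?_
      exact congrArg Sum.inl he
  · rintro ⟨⟨e, he⟩, hfin⟩
    refine ⟨⟨Sum.inl e, congrArg Sum.inl he⟩, ?_⟩
    refine ((hfin.image Sum.inl).union
      ((hfin.preimage (f := Subtype.val) Subtype.val_injective.injOn).image Sum.inr)).subset ?_
    rintro (f | f) hf
    · exact Or.inl ⟨f, Sum.inl_injective hf, rfl⟩
    · exact Or.inr ⟨f, Sum.inl_injective hf, rfl⟩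

lemma not_mem_Reg_ext_inr (y : ↥(G.Y X)) : (Sum.inr y : (G.ext X).Vert) ∉ (G.ext X).Reg := by
  rintro ⟨⟨f, hf⟩, -⟩
  rcases f with e | e <;> cases hf

/-- The edge `e` of `G`, as an edge of `G_X`. -/
def baseEdge (e : G.Edge) : (G.ext X).Edge := Sum.inl e

/-- The edge `e'` of `G_X`. -/
def primeEdge (e : {e : G.Edge // (G.r e ∩ G.Y X).Nonempty}) : (G.ext X).Edge := Sum.inr e

lemma edge_cases (f : (G.ext X).Edge) : (∃ e, f = baseEdge e) ∨ ∃ e, f = primeEdge e := by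
  rcases f with e | e
  · exact Or.inl ⟨e, rfl⟩
  · exact Or.inr ⟨e, rfl⟩

open scoped Classical in
/-- The value at `e'` of a function on the primed edges, and zero if `e'` does not exist. -/
noncomputable def primeVal {M : Type*} [Zero M] (F : {e : G.Edge // (G.r e ∩ G.Y X).Nonempty} → M)
    (e : G.Edge) : M := if h : (G.r e ∩ G.Y X).Nonempty then F ⟨e, h⟩ else 0

/-- A vertex `a` of `G` emits in `G_X` the edges `e` and `e'` for the edges `e` that it emits
in `G`. -/
lemma finsum_source_ext {M : Type*} [AddCommMonoid M] (F : (G.ext X).Edge → M) {a : G.Vert}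
    (ha : a ∈ G.Reg) :
    ∑ᶠ (f : (G.ext X).Edge) (_ : (G.ext X).s f = Sum.inl a), F f
      = ∑ᶠ (e : G.Edge) (_ : G.s e = a),
          (F (baseEdge e) + primeVal (fun e => F (primeEdge e)) e) := by
  classical
  have hprime : ∑ᶠ e ∈ {e : {e : G.Edge // (G.r e ∩ G.Y X).Nonempty} | G.s e.1 = a}, F (primeEdge e)
      = ∑ᶠ e ∈ {e | G.s e = a}, primeVal (fun e => F (primeEdge e)) e := by
    have h1 := finsum_mem_image (g := Subtype.val)
      (s := {e : {e : G.Edge // (G.r e ∩ G.Y X).Nonempty} | G.s e.1 = a})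
      (f := primeVal (fun e => F (primeEdge e))) Subtype.val_injective.injOn
    have h2 (e : {e : G.Edge // (G.r e ∩ G.Y X).Nonempty}) :
        primeVal (fun e => F (primeEdge e)) e.1 = F (primeEdge e) := by
      simp [primeVal, e.2]
    simp only [h2] at h1
    rw [← h1]
    refine finsum_congr fun e => ?_
    by_cases he : (G.r e ∩ G.Y X).Nonempty
    · refine finsum_congr_Prop ?_ fun _ => rfl
      simp [he]
    · simp [primeVal, he]
  refine (finsum_mem_sum F (T₁ := {e | G.s e = a})
    (T₂ := {e : {e : G.Edge // (G.r e ∩ G.Y X).Nonempty} | G.s e.1 = a}) ha.2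
    (ha.2.preimage Subtype.val_injective.injOn) (fun e => Sum.inl_injective.eq_iff)
    (fun e => Sum.inl_injective.eq_iff)).trans ?_
  refine (congrArg _ hprime).trans ?_
  exact (finsum_mem_add_distrib ha.2).symm

end Finiteness

end Ultragraph

namespace Ultragraph

variable {G : Ultragraph.{u, v}} {X : Set G.Vert}

namespace Fam

lemma base_inter (Z W : (G.ext X).Fam) : (Z.inter W).base = Z.base.inter W.base := rfl

lemma base_union (Z W : (G.ext X).Fam) : (Z.union W).base = Z.base.union W.base := rfl

lemma base_empty : (Fam.empty : (G.ext X).Fam).base = Fam.empty := rfl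

lemma top_inter (Z W : (G.ext X).Fam) : (Z.inter W).top = Z.top ∩ W.top :=
  Set.ext fun _ => ⟨fun ⟨h, h1, h2⟩ => ⟨⟨h, h1⟩, ⟨h, h2⟩⟩, fun ⟨⟨h, h1⟩, ⟨_, h2⟩⟩ => ⟨h, h1, h2⟩⟩

lemma top_union (Z W : (G.ext X).Fam) : (Z.union W).top = Z.top ∪ W.top :=
  Set.ext fun _ => ⟨fun ⟨h, h1⟩ => h1.imp (fun h1 => ⟨h, h1⟩) (fun h1 => ⟨h, h1⟩),
    fun h => h.elim (fun ⟨h, h1⟩ => ⟨h, Or.inl h1⟩) (fun ⟨h, h1⟩ => ⟨h, Or.inr h1⟩)⟩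

lemma top_empty : (Fam.empty : (G.ext X).Fam).top = ∅ :=
  Set.eq_empty_of_forall_notMem fun _ h => h.2

lemma base_vert_inl (a : G.Vert) :
    (Fam.vert (Sum.inl a : (G.ext X).Vert) : (G.ext X).Fam).base = Fam.vert a :=
  Subtype.ext (Set.ext fun _ => Sum.inl_injective.eq_iff)

lemma top_vert_inl (a : G.Vert) :
    (Fam.vert (Sum.inl a : (G.ext X).Vert) : (G.ext X).Fam).top = ∅ :=
  Set.eq_empty_of_forall_notMem fun _ ⟨_, h⟩ => Sum.inr_ne_inl h

lemma base_range_inl (e : G.Edge) :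
    (Fam.range (baseEdge e : (G.ext X).Edge) : (G.ext X).Fam).base = Fam.range e :=
  Subtype.ext (Set.preimage_image_eq _ Sum.inl_injective)

lemma top_range_inl (e : G.Edge) :
    (Fam.range (baseEdge e : (G.ext X).Edge) : (G.ext X).Fam).top = ∅ :=
  Set.eq_empty_of_forall_notMem fun _ ⟨_, _, _, h⟩ => Sum.inl_ne_inr h

lemma base_range_inr (e : {e : G.Edge // (G.r e ∩ G.Y X).Nonempty}) :
    (Fam.range (primeEdge e : (G.ext X).Edge) : (G.ext X).Fam).base = Fam.empty :=
  Subtype.ext (Set.eq_empty_of_forall_notMem fun _ ⟨_, _, h⟩ => Sum.inl_ne_inr h)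

lemma top_range_inr (e : {e : G.Edge // (G.r e ∩ G.Y X).Nonempty}) :
    (Fam.range (primeEdge e : (G.ext X).Edge) : (G.ext X).Fam).top = G.r e.1 ∩ G.Y X := by
  ext a
  constructor
  · rintro ⟨ha, y, hy, h⟩
    cases h
    exact ⟨hy, ha⟩
  · rintro ⟨ha, hY⟩
    exact ⟨hY, ⟨a, hY⟩, ha, rfl⟩

lemma ext_of_base_top {Z W : (G.ext X).Fam} (h1 : Z.base = W.base) (h2 : Z.top = W.top) :
    Z = W :=
  Subtype.ext (by rw [Z.decomposition, W.decomposition, h1, h2])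

lemma isGen_image_inl {A : Set G.Vert} (hA : G.IsGen A) :
    (G.ext X).IsGen (Sum.inl '' A : Set (G.Vert ⊕ ↥(G.Y X))) := by
  induction hA with
  | empty =>
    rw [Set.image_empty]
    exact .empty
  | singleton a =>
    rw [Set.image_singleton]
    exact .singleton (G := G.ext X) (Sum.inl a)
  | range e => exact .range (G := G.ext X) (Sum.inl e)
  | union _ _ h1 h2 =>
    rw [Set.image_union]
    exact .union h1 h2
  | inter _ _ h1 h2 =>
    rw [Set.image_inter Sum.inl_injective]
    exact .inter h1 h2

lemma isGen_primed {F : Set G.Vert} (hF : (F ∩ G.Y X).Finite) : (G.ext X).IsGen (G.primed X F) := by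
  refine isGen_of_finite (G := G.ext X) (Set.Finite.subset
    ((hF.preimage (f := (Subtype.val : ↥(G.Y X) → G.Vert)) Subtype.val_injective.injOn).image
      Sum.inr) ?_)
  rintro z ⟨y, hy, rfl⟩
  exact ⟨y, ⟨hy, y.2⟩, rfl⟩

/-- The set `A ∪ (F ∩ Y)'` of vertices of `G_X`. -/
def join (A : G.Fam) (F : Set G.Vert) (hF : (F ∩ G.Y X).Finite) : (G.ext X).Fam :=
  ⟨Sum.inl '' A.1 ∪ G.primed X F, .union (isGen_image_inl A.2) (isGen_primed hF)⟩

lemma base_join (A : G.Fam) (F : Set G.Vert) (hF : (F ∩ G.Y X).Finite) :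
    (join A F hF).base = A := by
  refine Subtype.ext (Set.ext fun a => ⟨?_, fun ha => Or.inl ⟨a, ha, rfl⟩⟩)
  rintro (⟨b, hb, h⟩ | ⟨y, hy, h⟩)
  · cases h
    exact hb
  · cases h

lemma top_join (A : G.Fam) (F : Set G.Vert) (hF : (F ∩ G.Y X).Finite) :
    (join A F hF).top = F ∩ G.Y X := by
  refine Set.ext fun a => ⟨?_, fun ha => ⟨ha.2, Or.inr ⟨⟨a, ha.2⟩, ha.1, rfl⟩⟩⟩
  rintro ⟨ha, ⟨b, hb, h⟩ | ⟨y, hy, h⟩⟩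
  · cases h
  · cases h
    exact ⟨hy, ha⟩

end Fam

/-- The edge of `G` from which an edge of `G_X` arises. -/
def origin (f : (G.ext X).Edge) : G.Edge := Sum.elim id Subtype.val f

lemma s_ext (f : (G.ext X).Edge) : (G.ext X).s f = Sum.inl (G.s (origin f)) := by
  rcases f with e | e <;> rfl

namespace Fam

lemma range_inter_range_eq_empty {f f' : (G.ext X).Edge} (hff : origin f = origin f')
    (hf : f ≠ f') : (Fam.range f).inter (Fam.range f') = (Fam.empty : (G.ext X).Fam) := by
  obtain ⟨e, rfl⟩ | ⟨e, rfl⟩ := edge_cases f <;>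
    obtain ⟨e', rfl⟩ | ⟨e', rfl⟩ := edge_cases f'
  · exact absurd (congrArg baseEdge hff) hf
  · refine ext_of_base_top ?_ ?_
    · rw [base_inter, base_range_inr, base_empty]
      exact Subtype.ext (inter_empty _)
    · rw [top_inter, top_range_inl, empty_inter, top_empty]
  · refine ext_of_base_top ?_ ?_
    · rw [base_inter, base_range_inr, base_empty]
      exact Subtype.ext (empty_inter _)
    · rw [top_inter, top_range_inl, inter_empty, top_empty]
  · exact absurd (congrArg primeEdge (Subtype.ext hff)) hf

lemma range_inter_join (hfin : ∀ e, (G.r e ∩ G.Y X).Finite) (f : (G.ext X).Edge) :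
    (Fam.range f).inter (join (Fam.range (origin f)) (G.r (origin f)) (hfin _)) = Fam.range f := by
  obtain ⟨e, rfl⟩ | ⟨e, rfl⟩ := edge_cases f <;> refine ext_of_base_top ?_ ?_
  · rw [base_inter, base_join, base_range_inl]
    exact inter_self _
  · rw [top_inter, top_range_inl, empty_inter]
  · rw [base_inter, base_range_inr]
    exact Subtype.ext (empty_inter _)
  · rw [top_inter, top_range_inr, top_join]
    exact Set.inter_self _

lemma range_base_union_prime (hfin : ∀ e, (G.r e ∩ G.Y X).Finite)
    (e : {e : G.Edge // (G.r e ∩ G.Y X).Nonempty}) :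
    (Fam.range (baseEdge e.1 : (G.ext X).Edge)).union (Fam.range (primeEdge e))
      = join (Fam.range e.1) (G.r e.1) (hfin _) := by
  refine ext_of_base_top ?_ ?_
  · rw [base_union, base_range_inl, base_range_inr, base_join]
    exact Subtype.ext (union_empty _)
  · rw [top_union, top_range_inl, top_range_inr, top_join, empty_union]

lemma range_base_eq_join (hfin : ∀ e, (G.r e ∩ G.Y X).Finite) {e : G.Edge}
    (he : ¬ (G.r e ∩ G.Y X).Nonempty) :
    Fam.range (baseEdge e : (G.ext X).Edge) = join (Fam.range e) (G.r e) (hfin _) := by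
  refine ext_of_base_top ?_ ?_
  · rw [base_range_inl, base_join]
  · rw [top_range_inl, top_join, Set.not_nonempty_iff_eq_empty.mp he]

end Fam

variable {B : Type*} [NonUnitalCStarAlgebra B]

/-! ### The family for `G_X` in `C*(G, X)` -/

/-- The projection that a relative family for `G` assigns to a vertex set `Z` of `G_X`. -/
noncomputable def extP (S : G.Edge → B) (P : G.Fam → B) (Z : (G.ext X).Fam) : B :=
  P Z.base - gapSum S P (Z.base.1 ∩ G.Y X) + gapSum S P Z.top

/-- The partial isometry that a relative family for `G` assigns to an edge of `G_X`. -/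
noncomputable def extS (S : G.Edge → B) (P : G.Fam → B) (f : (G.ext X).Edge) : B :=
  S (origin f) * extP S P (Fam.range f)

namespace IsFamily

variable {S : G.Edge → B} {P : G.Fam → B} (h : IsFamily X S P)
  (hfin : ∀ e, (G.r e ∩ G.Y X).Finite)
include h hfin

lemma star_extP (Z : (G.ext X).Fam) : star (extP S P Z) = extP S P Z := by
  have h1 := finite_inter_Y hfin Z.base.2
  rw [extP, star_add, star_sub, h.p_star, h.star_gapSum h1 (inter_subset_right.trans Y_subset_Reg),
    h.star_gapSum (Z.finite_top hfin) (Z.top_subset_Y.trans Y_subset_Reg)]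

lemma extP_mul_extP (Z W : (G.ext X).Fam) : extP S P Z * extP S P W = extP S P (Z.inter W) := by
  obtain ⟨A, hA⟩ : ∃ A, A = Z.base := ⟨_, rfl⟩
  obtain ⟨A', hA'⟩ : ∃ A, A = W.base := ⟨_, rfl⟩
  obtain ⟨T, hT⟩ : ∃ A, A = Z.top := ⟨_, rfl⟩
  obtain ⟨T', hT'⟩ : ∃ A, A = W.top := ⟨_, rfl⟩
  have fA := finite_inter_Y hfin A.2
  have fA' := finite_inter_Y hfin A'.2
  have fT : T.Finite := hT ▸ Z.finite_top hfin
  have fT' : T'.Finite := hT' ▸ W.finite_top hfin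
  have yT : T ⊆ G.Y X := hT ▸ Z.top_subset_Y
  have yT' : T' ⊆ G.Y X := hT' ▸ W.top_subset_Y
  have rT := yT.trans Y_subset_Reg
  have rT' := yT'.trans Y_subset_Reg
  have rA : A.1 ∩ G.Y X ⊆ G.Reg := inter_subset_right.trans Y_subset_Reg
  have rA' : A'.1 ∩ G.Y X ⊆ G.Reg := inter_subset_right.trans Y_subset_Reg
  have e1 : A.1 ∩ (A'.1 ∩ G.Y X) = (A.inter A').1 ∩ G.Y X := (inter_assoc _ _ _).symm
  have e2 : A'.1 ∩ (A.1 ∩ G.Y X) = (A.inter A').1 ∩ G.Y X := by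
    rw [Fam.inter_comm]
    exact (inter_assoc _ _ _).symm
  have e3 : (A.1 ∩ G.Y X) ∩ (A'.1 ∩ G.Y X) = (A.inter A').1 ∩ G.Y X :=
    (inter_inter_distrib_right _ _ _).symm
  have e4 : (A.1 ∩ G.Y X) ∩ T' = A.1 ∩ T' := by
    rw [inter_assoc, inter_eq_right.mpr yT']
  have e5 : T ∩ (A'.1 ∩ G.Y X) = A'.1 ∩ T := by
    rw [inter_comm, inter_assoc, inter_eq_right.mpr yT]
  simp only [extP, Fam.base_inter, Fam.top_inter, ← hA, ← hA', ← hT, ← hT']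
  simp only [add_mul, sub_mul, mul_add, mul_sub]
  rw [h.p_inter, h.p_mul_gapSum A fA' rA', h.p_mul_gapSum A fT' rT', h.gapSum_mul_p A' fA rA,
    h.gapSum_mul_gapSum fA rA fA' rA', h.gapSum_mul_gapSum fA rA fT' rT',
    h.gapSum_mul_p A' fT rT, h.gapSum_mul_gapSum fT rT fA' rA',
    h.gapSum_mul_gapSum fT rT fT' rT', e1, e2, e3, e4, e5]
  abel

omit hfin in
lemma extP_eq_zero {Z : (G.ext X).Fam} (hb : Z.base = Fam.empty) (ht : Z.top = ∅) :
    extP S P Z = 0 := by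
  rw [extP, hb, ht, h.p_empty]
  simp [Fam.empty, gapSum]

omit h in
/-- `A` and `A ∪ (A ∩ Y)'` have the same projection. -/
lemma extP_join (A : G.Fam) : extP S P (Fam.join A A.1 (finite_inter_Y hfin A.2)) = P A := by
  rw [extP, Fam.base_join, Fam.top_join, sub_add_cancel]

lemma p_range_mul_extP (f : (G.ext X).Edge) :
    P (Fam.range (origin f)) * extP S P (Fam.range f) = extP S P (Fam.range f) := by
  rw [← extP_join (P := P) (S := S) hfin, h.extP_mul_extP hfin, Fam.inter_comm]
  exact congrArg _ (Fam.range_inter_join hfin f)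

omit hfin in
lemma extP_range_inl_add (e : G.Edge) :
    extP S P (Fam.range (baseEdge e : (G.ext X).Edge))
      + primeVal (fun e => extP S P (Fam.range (primeEdge e : (G.ext X).Edge))) e
      = P (Fam.range e) := by
  classical
  have h1 : extP S P (Fam.range (baseEdge e : (G.ext X).Edge))
      = P (Fam.range e) - gapSum S P (G.r e ∩ G.Y X) := by
    rw [extP, Fam.base_range_inl, Fam.top_range_inl, gapSum, gapSum, finsum_mem_empty, add_zero]
    rfl
  rw [h1]
  by_cases he : (G.r e ∩ G.Y X).Nonempty
  · rw [primeVal, dif_pos he, extP, Fam.base_range_inr, Fam.top_range_inr, h.p_empty]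
    simp [Fam.empty, gapSum]
  · rw [primeVal, dif_neg he, Set.not_nonempty_iff_eq_empty.mp he]
    simp [gapSum]

omit hfin in
lemma extS_inl_add (e : G.Edge) :
    extS S P (baseEdge e : (G.ext X).Edge)
      + primeVal (fun e => extS S P (primeEdge e : (G.ext X).Edge)) e = S e := by
  have h1 : primeVal (fun e => extS S P (primeEdge e : (G.ext X).Edge)) e
      = S e * primeVal (fun e => extP S P (Fam.range (primeEdge e : (G.ext X).Edge))) e := by
    unfold primeVal
    split_ifs
    · rfl
    · rw [mul_zero]
  calc _ = S e * (extP S P (Fam.range (baseEdge e : (G.ext X).Edge))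
        + primeVal (fun e => extP S P (Fam.range (primeEdge e : (G.ext X).Edge))) e) := by
        rw [h1, mul_add]
        rfl
    _ = S e := by rw [h.extP_range_inl_add, h.mul_range]

lemma extP_mul_self (Z : (G.ext X).Fam) : extP S P Z * extP S P Z = extP S P Z := by
  rw [h.extP_mul_extP hfin, Fam.inter_self]

lemma extS_mul_star (f : (G.ext X).Edge) : extS S P f * star (extS S P f)
    = S (origin f) * extP S P (Fam.range f) * star (S (origin f)) := by
  rw [extS, star_mul, h.star_extP hfin, mul_assoc, ← mul_assoc (extP S P _),
    h.extP_mul_self hfin, mul_assoc]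

lemma extS_mul_star_add (e : G.Edge) :
    extS S P (baseEdge e : (G.ext X).Edge) * star (extS S P (baseEdge e : (G.ext X).Edge))
      + primeVal (fun e => extS S P (primeEdge e : (G.ext X).Edge)
        * star (extS S P (primeEdge e : (G.ext X).Edge))) e = S e * star (S e) := by
  have h1 : primeVal (fun e => extS S P (primeEdge e : (G.ext X).Edge)
        * star (extS S P (primeEdge e : (G.ext X).Edge))) e
      = S e * primeVal (fun e => extP S P (Fam.range (primeEdge e : (G.ext X).Edge))) e
        * star (S e) := by
    unfold primeVal
    split_ifs
    · exact h.extS_mul_star hfin _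
    · rw [mul_zero, zero_mul]
  calc _ = S e * (extP S P (Fam.range (baseEdge e : (G.ext X).Edge))
        + primeVal (fun e => extP S P (Fam.range (primeEdge e : (G.ext X).Edge))) e)
        * star (S e) := by
        rw [h1, h.extS_mul_star hfin, mul_add, add_mul]
        rfl
    _ = S e * star (S e) := by rw [h.extP_range_inl_add, h.mul_range]

/-- A relative family for `G` gives a family for `G_X`. -/
lemma extend : IsFamily (G.ext X).Reg (extS (X := X) S P) (extP S P) where
  p_star := h.star_extP hfin
  p_inter := h.extP_mul_extP hfin
  p_empty := h.extP_eq_zero Fam.base_empty Fam.top_empty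
  p_union Z W := by
    have h1 : (Z.base.union W.base).1 ∩ G.Y X = (Z.base.1 ∩ G.Y X) ∪ (W.base.1 ∩ G.Y X) :=
      union_inter_distrib_right _ _ _
    have h2 : (Z.base.1 ∩ G.Y X) ∩ (W.base.1 ∩ G.Y X) = (Z.base.inter W.base).1 ∩ G.Y X :=
      (inter_inter_distrib_right _ _ _).symm
    simp only [extP, Fam.base_union, Fam.base_inter, Fam.top_union, Fam.top_inter, h.p_union, h1]
    rw [gapSum_union (finite_inter_Y hfin Z.base.2) (finite_inter_Y hfin W.base.2),
      gapSum_union (Z.finite_top hfin) (W.finite_top hfin), h2]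
    abel
  s_orthogonal f f' hf := by
    have key : origin f = origin f' → extP S P (Fam.range f) * extP S P (Fam.range f') = 0 := by
      intro hff
      rw [h.extP_mul_extP hfin]
      rw [Fam.range_inter_range_eq_empty hff hf]
      exact h.extP_eq_zero Fam.base_empty Fam.top_empty
    rw [extS, extS, star_mul, h.star_extP hfin, mul_assoc, ← mul_assoc (star (S _))]
    by_cases hff : origin f = origin f'
    · rw [hff, h.s_source, h.p_range_mul_extP hfin, key hff]
    · rw [h.s_orthogonal _ _ hff, zero_mul, mul_zero]
  s_source f := by
    rw [extS, star_mul, h.star_extP hfin, mul_assoc, ← mul_assoc (star (S _)), h.s_source,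
      h.p_range_mul_extP hfin, h.extP_mul_self hfin]
  mul_range f := by
    rw [extS, mul_assoc, h.extP_mul_self hfin]
  source_mul f := by
    rw [s_ext, extS, ← mul_assoc, extP, Fam.base_vert_inl, Fam.top_vert_inl, add_mul, sub_mul,
      h.source_mul, h.gapSum_mul_s (finite_inter_Y hfin (Fam.vert _).2)
        (inter_subset_right.trans Y_subset_Reg)]
    simp [gapSum]
  cuntzKrieger a ha := by
    rcases a with a | y
    · have ha' : a ∈ G.Reg := mem_Reg_ext_inl.mp ha
      refine Eq.trans ?_ (finsum_source_ext _ ha').symm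
      simp only [h.extS_mul_star_add hfin]
      change _ = outSum S a
      rw [extP, Fam.base_vert_inl, Fam.top_vert_inl]
      have h0 : gapSum S P (∅ : Set G.Vert) = 0 := finsum_mem_empty
      rw [h0, add_zero]
      by_cases haX : a ∈ X
      · have h1 : (Fam.vert a : G.Fam).1 ∩ G.Y X = ∅ :=
          Set.singleton_inter_eq_empty.mpr fun h => h.2 haX
        rw [h1, h0, sub_zero]
        exact h.cuntzKrieger a haX
      · have h1 : (Fam.vert a : G.Fam).1 ∩ G.Y X = {a} :=
          Set.inter_eq_left.mpr (Set.singleton_subset_iff.mpr ⟨ha', haX⟩)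
        rw [h1, gapSum, finsum_mem_singleton, gap, sub_sub_cancel]
    · exact absurd ha (not_mem_Reg_ext_inr y)

end IsFamily

/-! ### The relative family for `G` in `C*(G_X)` -/

/-- The projection that a family for `G_X` assigns to a vertex set of `G`. -/
def resP (hfin : ∀ e, (G.r e ∩ G.Y X).Finite) (P : (G.ext X).Fam → B) (A : G.Fam) : B :=
  P (Fam.join A A.1 (finite_inter_Y hfin A.2))

/-- The partial isometry that a family for `G_X` assigns to an edge of `G`. -/
noncomputable def resS (S : (G.ext X).Edge → B) (e : G.Edge) : B :=
  S (baseEdge e) + primeVal (fun e => S (primeEdge e)) e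

namespace IsFamily

variable {S : (G.ext X).Edge → B} {P : (G.ext X).Fam → B} (h : IsFamily (G.ext X).Reg S P)
  (hfin : ∀ e, (G.r e ∩ G.Y X).Finite)
include h

lemma star_mul_eq_zero_of_origin_ne {f f' : (G.ext X).Edge} (hf : origin f ≠ origin f') :
    star (S f) * S f' = 0 :=
  h.s_orthogonal _ _ fun hff => hf (congrArg origin hff)

lemma star_base_mul_prime (e : G.Edge) (e' : {e : G.Edge // (G.r e ∩ G.Y X).Nonempty}) :
    star (S (baseEdge e)) * S (primeEdge e') = 0 :=
  h.s_orthogonal _ _ Sum.inl_ne_inr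

lemma star_prime_mul_base (e : G.Edge) (e' : {e : G.Edge // (G.r e ∩ G.Y X).Nonempty}) :
    star (S (primeEdge e')) * S (baseEdge e) = 0 :=
  h.s_orthogonal _ _ Sum.inr_ne_inl

lemma star_resS_mul (f : (G.ext X).Edge) :
    star (resS S (origin f)) * S f = P (Fam.range f) := by
  obtain ⟨e, rfl⟩ | ⟨e, rfl⟩ := edge_cases f
  · change star (resS S e) * _ = _
    rw [resS, star_add, add_mul, h.s_source, primeVal]
    split_ifs with he
    · rw [h.star_prime_mul_base, add_zero]
    · rw [star_zero, zero_mul, add_zero]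
  · change star (resS S e.1) * _ = _
    rw [resS, star_add, add_mul, primeVal, dif_pos e.2, h.s_source, h.star_base_mul_prime,
      zero_add]

lemma star_resS_mul_eq_zero {e : G.Edge} {f : (G.ext X).Edge} (hf : e ≠ origin f) :
    star (resS S e) * S f = 0 := by
  rw [resS, star_add, add_mul,
    h.star_mul_eq_zero_of_origin_ne (f := baseEdge e) hf, zero_add, primeVal]
  split_ifs with he
  · exact h.star_mul_eq_zero_of_origin_ne (f := primeEdge ⟨e, he⟩) hf
  · rw [star_zero, zero_mul]

lemma p_mul_p_eq_zero {Z W : (G.ext X).Fam} (hb : Z.base.1 ∩ W.base.1 = ∅)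
    (ht : Z.top ∩ W.top = ∅) : P Z * P W = 0 := by
  rw [h.p_inter, ← h.p_empty]
  congr 1
  exact Fam.ext_of_base_top (Subtype.ext hb) (by rw [Fam.top_inter, ht, Fam.top_empty])

lemma p_add_p {Z W V : (G.ext X).Fam} (hb : Z.base.1 ∩ W.base.1 = ∅)
    (ht : Z.top ∩ W.top = ∅) (hb' : Z.base.1 ∪ W.base.1 = V.base.1) (ht' : Z.top ∪ W.top = V.top) :
    P Z + P W = P V := by
  have h1 := h.p_union Z W
  rw [← h.p_inter, h.p_mul_p_eq_zero hb ht, sub_zero] at h1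
  rw [← h1]
  congr 1
  exact Fam.ext_of_base_top (Subtype.ext hb') (by rw [Fam.top_union, ht'])

lemma p_range_inl_mul_inr (e : G.Edge) (e' : {e : G.Edge // (G.r e ∩ G.Y X).Nonempty}) :
    P (Fam.range (baseEdge e)) * P (Fam.range (primeEdge e')) = 0 := by
  apply h.p_mul_p_eq_zero
  · rw [Fam.base_range_inr]
    exact inter_empty _
  · rw [Fam.top_range_inl, empty_inter]

lemma p_range_inr_mul_inl (e : G.Edge) (e' : {e : G.Edge // (G.r e ∩ G.Y X).Nonempty}) :
    P (Fam.range (primeEdge e')) * P (Fam.range (baseEdge e)) = 0 := by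
  rw [h.p_inter, Fam.inter_comm, ← h.p_inter, h.p_range_inl_mul_inr]

lemma s_inl_mul_star_inr (e : G.Edge) (e' : {e : G.Edge // (G.r e ∩ G.Y X).Nonempty}) :
    S (baseEdge e) * star (S (primeEdge e')) = 0 := by
  rw [← h.mul_range (baseEdge e), ← h.mul_range (primeEdge e'), star_mul, h.p_star, mul_assoc,
    ← mul_assoc (P _), h.p_range_inl_mul_inr, zero_mul, mul_zero]

lemma resS_mul_p_range (f : (G.ext X).Edge) : resS S (origin f) * P (Fam.range f) = S f := by
  obtain ⟨e, rfl⟩ | ⟨e, rfl⟩ := edge_cases f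
  · change resS S e * _ = _
    rw [resS, add_mul, h.mul_range, primeVal]
    split_ifs with he
    · rw [← h.mul_range (primeEdge ⟨e, he⟩), mul_assoc, h.p_range_inr_mul_inl, mul_zero, add_zero]
    · rw [zero_mul, add_zero]
  · change resS S e.1 * _ = _
    rw [resS, add_mul, primeVal, dif_pos e.2, ← h.mul_range (baseEdge e.1), mul_assoc,
      h.p_range_inl_mul_inr, mul_zero, zero_add, h.mul_range]

lemma resS_mul_star (e : G.Edge) : resS S e * star (resS S e)
    = S (baseEdge e) * star (S (baseEdge e))
      + primeVal (fun e => S (primeEdge e) * star (S (primeEdge e))) e := by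
  have h1 (e' : {e : G.Edge // (G.r e ∩ G.Y X).Nonempty}) :
      S (primeEdge e') * star (S (baseEdge e)) = 0 := by
    rw [← star_star (S (primeEdge e')), ← star_mul, h.s_inl_mul_star_inr, star_zero]
  unfold resS primeVal
  split_ifs with he
  · rw [star_add, add_mul, mul_add, mul_add, h.s_inl_mul_star_inr, h1, add_zero, zero_add]
  · simp

lemma outSum_resS {a : G.Vert} (ha : a ∈ G.Reg) :
    outSum (resS S) a = P (Fam.vert (Sum.inl a)) := by
  rw [h.cuntzKrieger _ (mem_Reg_ext_inl.mpr ha)]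
  refine Eq.trans ?_ (finsum_source_ext _ ha).symm
  simp only [outSum, h.resS_mul_star]

lemma gap_res {a : G.Vert} (ha : a ∈ G.Y X) :
    gap (resS S) (resP hfin P) a = P (Fam.vert (Sum.inr ⟨a, ha⟩)) := by
  rw [gap, h.outSum_resS ha.1, sub_eq_iff_eq_add']
  refine (h.p_add_p ?_ ?_ ?_ ?_).symm
  · refine Set.eq_empty_of_forall_notMem fun b hb => ?_
    cases hb.2
  · rw [Fam.top_vert_inl, empty_inter]
  · rw [Fam.base_join, Fam.base_vert_inl]
    refine Set.union_eq_self_of_subset_right fun b hb => ?_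
    cases hb
  · rw [Fam.top_join, Fam.top_vert_inl, empty_union]
    ext b
    constructor
    · rintro ⟨hb, h⟩
      cases h
      exact ⟨rfl, hb⟩
    · rintro ⟨hb, -⟩
      cases hb
      exact ⟨ha, rfl⟩

lemma gapSum_res {F : Set G.Vert} (hF : F.Finite) (hY : F ⊆ G.Y X) :
    gapSum (resS S) (resP hfin P) F
      = P (Fam.join Fam.empty F (hF.subset inter_subset_left)) := by
  have h1 : P (Fam.join Fam.empty F (hF.subset inter_subset_left)) =
      ∑ᶠ z ∈ (Fam.join Fam.empty F (hF.subset inter_subset_left) : (G.ext X).Fam).1,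
        P (Fam.vert z) :=
    h.p_eq_finsum _ (((hF.preimage (f := (Subtype.val : ↥(G.Y X) → G.Vert))
      Subtype.val_injective.injOn).image Sum.inr).subset (by
        rintro z (⟨a, ha, -⟩ | ⟨y, hy, rfl⟩)
        · exact ha.elim
        · exact ⟨y, hy, rfl⟩))
  have h2 : (Fam.join Fam.empty F (hF.subset inter_subset_left) : (G.ext X).Fam).1
      = Sum.inr '' (Subtype.val ⁻¹' F : Set ↥(G.Y X)) := by
    ext z
    constructor
    · rintro (⟨a, ha, -⟩ | ⟨y, hy, rfl⟩)
      · exact ha.elim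
      · exact ⟨y, hy, rfl⟩
    · rintro ⟨y, hy, rfl⟩
      exact Or.inr ⟨y, hy, rfl⟩
  have h3 : F = Subtype.val '' (Subtype.val ⁻¹' F : Set ↥(G.Y X)) := by
    rw [Subtype.image_preimage_coe, Set.inter_eq_right.mpr hY]
  rw [h1, h2]
  refine Eq.trans ?_ (finsum_mem_image (f := fun z : (G.ext X).Vert => P (Fam.vert z))
    Sum.inr_injective.injOn).symm
  rw [gapSum]
  conv_lhs => rw [h3]
  rw [finsum_mem_image Subtype.val_injective.injOn]
  exact finsum_mem_congr rfl fun y _ => h.gap_res hfin y.2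

lemma extP_res (Z : (G.ext X).Fam) : extP (resS S) (resP hfin P) Z = P Z := by
  rw [extP, h.gapSum_res hfin (finite_inter_Y hfin Z.base.2) inter_subset_right,
    h.gapSum_res hfin (Z.finite_top hfin) Z.top_subset_Y]
  have h1 : P (Fam.join Z.base ∅ (by simp))
      + P (Fam.join Fam.empty (Z.base.1 ∩ G.Y X)
        ((finite_inter_Y hfin Z.base.2).subset inter_subset_left)) = resP hfin P Z.base := by
    refine h.p_add_p ?_ ?_ ?_ ?_
    · rw [Fam.base_join, Fam.base_join]
      exact inter_empty _
    · rw [Fam.top_join, empty_inter, empty_inter]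
    · rw [Fam.base_join, Fam.base_join, Fam.base_join]
      exact union_empty _
    · rw [Fam.top_join, Fam.top_join, Fam.top_join, empty_inter, empty_union, inter_assoc,
        inter_self]
  rw [← h1, add_sub_cancel_right]
  refine h.p_add_p ?_ ?_ ?_ ?_
  · rw [Fam.base_join, Fam.base_join]
    exact inter_empty _
  · rw [Fam.top_join, empty_inter, empty_inter]
  · rw [Fam.base_join, Fam.base_join]
    exact union_empty _
  · rw [Fam.top_join, Fam.top_join, empty_inter, empty_union,
      Set.inter_eq_left.mpr Z.top_subset_Y]

lemma extS_res (f : (G.ext X).Edge) : extS (resS S) (resP hfin P) f = S f := by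
  rw [extS, h.extP_res hfin, h.resS_mul_p_range]

lemma p_range_add (e : G.Edge) :
    P (Fam.range (baseEdge e)) + primeVal (fun e => P (Fam.range (primeEdge e))) e
      = resP hfin P (Fam.range e) := by
  by_cases he : (G.r e ∩ G.Y X).Nonempty
  · rw [primeVal, dif_pos he]
    refine Eq.trans ?_ (congrArg P (Fam.range_base_union_prime hfin ⟨e, he⟩))
    rw [h.p_union, ← h.p_inter, h.p_range_inl_mul_inr, sub_zero]
  · rw [primeVal, dif_neg he, add_zero]
    exact congrArg P (Fam.range_base_eq_join hfin he)

lemma s_mul_resP (f : (G.ext X).Edge) : S f * resP hfin P (Fam.range (origin f)) = S f := by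
  rw [← h.mul_range f, mul_assoc, resP, h.p_inter]
  exact congrArg (fun Z => S f * P Z) (Fam.range_inter_join hfin f)

lemma resP_mul_s (f : (G.ext X).Edge) :
    resP hfin P (Fam.vert (G.s (origin f))) * S f = S f := by
  rw [← h.source_mul f, ← mul_assoc, resP, h.p_inter, s_ext]
  congr 2
  refine Fam.ext_of_base_top ?_ ?_
  · rw [Fam.base_inter, Fam.base_join, Fam.base_vert_inl, Fam.inter_self]
  · rw [Fam.top_inter, Fam.top_vert_inl, inter_empty]

/-- A family for `G_X` gives a relative family for `G`. -/
lemma restrict (hX : X ⊆ G.Reg) : IsFamily X (resS S) (resP hfin P) where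
  p_star A := h.p_star _
  p_inter A A' := by
    rw [resP, resP, h.p_inter]
    congr 1
    refine Fam.ext_of_base_top ?_ ?_
    · rw [Fam.base_inter, Fam.base_join, Fam.base_join, Fam.base_join]
    · rw [Fam.top_inter, Fam.top_join, Fam.top_join, Fam.top_join]
      exact (inter_inter_distrib_right _ _ _).symm
  p_empty := by
    rw [← h.p_empty]
    refine congrArg P (Fam.ext_of_base_top ?_ ?_)
    · rw [Fam.base_join, Fam.base_empty]
    · rw [Fam.top_join, Fam.top_empty]
      exact empty_inter _
  p_union A A' := by
    have h1 := h.p_union (Fam.join A A.1 (finite_inter_Y hfin A.2))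
      (Fam.join A' A'.1 (finite_inter_Y hfin A'.2))
    have h2 : (Fam.join A A.1 (finite_inter_Y hfin A.2)).inter
        (Fam.join A' A'.1 (finite_inter_Y hfin A'.2))
        = Fam.join (A.inter A') (A.inter A').1 (finite_inter_Y hfin (A.inter A').2) := by
      refine Fam.ext_of_base_top ?_ ?_
      · rw [Fam.base_inter, Fam.base_join, Fam.base_join, Fam.base_join]
      · rw [Fam.top_inter, Fam.top_join, Fam.top_join, Fam.top_join]
        exact (inter_inter_distrib_right _ _ _).symm
    have h3 : (Fam.join A A.1 (finite_inter_Y hfin A.2)).union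
        (Fam.join A' A'.1 (finite_inter_Y hfin A'.2))
        = Fam.join (A.union A') (A.union A').1 (finite_inter_Y hfin (A.union A').2) := by
      refine Fam.ext_of_base_top ?_ ?_
      · rw [Fam.base_union, Fam.base_join, Fam.base_join, Fam.base_join]
      · rw [Fam.top_union, Fam.top_join, Fam.top_join, Fam.top_join]
        exact (union_inter_distrib_right _ _ _).symm
    rw [h2, h3] at h1
    exact h1
  s_orthogonal e e' he := by
    rw [resS.eq_1 S e', mul_add, h.star_resS_mul_eq_zero (f := baseEdge e') he, zero_add,
      primeVal]
    split_ifs with he'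
    · exact h.star_resS_mul_eq_zero (f := primeEdge ⟨e', he'⟩) he
    · rw [mul_zero]
  s_source e := by
    have h1 : star (resS S e) * S (baseEdge e) = P (Fam.range (baseEdge e)) :=
      h.star_resS_mul (baseEdge e)
    have h2 : star (resS S e) * primeVal (fun e => S (primeEdge e)) e
        = primeVal (fun e => P (Fam.range (primeEdge e))) e := by
      unfold primeVal
      split_ifs with he
      · exact h.star_resS_mul (primeEdge ⟨e, he⟩)
      · rw [mul_zero]
    rw [← h.p_range_add hfin, ← h1, ← h2, ← mul_add]
    rfl
  mul_range e := by
    have h1 : S (baseEdge e) * resP hfin P (Fam.range e) = S (baseEdge e) :=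
      h.s_mul_resP hfin (baseEdge e)
    have h2 : primeVal (fun e => S (primeEdge e)) e * resP hfin P (Fam.range e)
        = primeVal (fun e => S (primeEdge e)) e := by
      unfold primeVal
      split_ifs with he
      · exact h.s_mul_resP hfin (primeEdge ⟨e, he⟩)
      · rw [zero_mul]
    rw [resS, add_mul, h1, h2]
  source_mul e := by
    have h1 : resP hfin P (Fam.vert (G.s e)) * S (baseEdge e) = S (baseEdge e) :=
      h.resP_mul_s hfin (baseEdge e)
    have h2 : resP hfin P (Fam.vert (G.s e)) * primeVal (fun e => S (primeEdge e)) e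
        = primeVal (fun e => S (primeEdge e)) e := by
      unfold primeVal
      split_ifs with he
      · exact h.resP_mul_s hfin (primeEdge ⟨e, he⟩)
      · rw [mul_zero]
    rw [resS, mul_add, h1, h2]
  cuntzKrieger a ha := by
    refine Eq.trans ?_ (h.outSum_resS (hX ha)).symm
    refine congrArg P (Fam.ext_of_base_top ?_ ?_)
    · rw [Fam.base_join, Fam.base_vert_inl]
    · rw [Fam.top_join, Fam.top_vert_inl]
      exact Set.singleton_inter_eq_empty.mpr fun h => h.2 ha

end IsFamily

end Ultragraph

namespace Ultragraph

variable {G : Ultragraph.{u, v}} {X : Set G.Vert}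

/-! ### The isomorphism of the two algebras -/

section Map

variable {B C : Type*} [NonUnitalCStarAlgebra B] [NonUnitalCStarAlgebra C] (φ : B →⋆ₙₐ[ℂ] C)

lemma map_gapSum (S : G.Edge → B) (P : G.Fam → B) {F : Set G.Vert} (hF : F.Finite)
    (hR : F ⊆ G.Reg) :
    φ (gapSum S P F) = gapSum (fun e => φ (S e)) (fun A => φ (P A)) F := by
  refine ((φ : B →+ C).map_finsum_mem _ hF).trans (finsum_mem_congr rfl fun a ha => ?_)
  change φ (gap S P a) = _
  rw [gap, gap, map_sub]
  congr 1
  refine (map_finsum_source (φ : B →+ C) (hR ha) _).trans ?_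
  simp [outSum, map_star]

variable (hfin : ∀ e, (G.r e ∩ G.Y X).Finite)
include hfin

lemma map_extP (S : G.Edge → B) (P : G.Fam → B) (Z : (G.ext X).Fam) :
    φ (extP S P Z) = extP (fun e => φ (S e)) (fun A => φ (P A)) Z := by
  rw [extP, map_add, map_sub, map_gapSum φ S P (finite_inter_Y hfin Z.base.2)
    (inter_subset_right.trans Y_subset_Reg), map_gapSum φ S P (Z.finite_top hfin)
    (Z.top_subset_Y.trans Y_subset_Reg)]
  rfl

lemma map_extS (S : G.Edge → B) (P : G.Fam → B) (f : (G.ext X).Edge) :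
    φ (extS S P f) = extS (fun e => φ (S e)) (fun A => φ (P A)) f := by
  rw [extS, map_mul, map_extP φ hfin]
  rfl

omit hfin in
lemma map_resS (S : (G.ext X).Edge → B) (e : G.Edge) :
    φ (resS S e) = resS (fun f => φ (S f)) e := by
  rw [resS, map_add, resS, primeVal, primeVal]
  split_ifs
  · rfl
  · rw [map_zero]

end Map

/-- The equations that determine the isomorphism, in terms of the family for `G_X` built from the
generators of `C*(G, X)`. -/
lemma isPsi_iff (hX : X ⊆ G.Reg) (hfin : ∀ e, (G.r e ∩ G.Y X).Finite)
    (ψ : (G.ext X).Alg (G.ext X).Reg → G.Alg X) :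
    IsPsi hfin ψ ↔ (∀ Z, ψ (Alg.p _ Z) = extP (Alg.s X) (Alg.p X) Z) ∧
      ∀ f, ψ (Alg.s _ f) = extS (Alg.s X) (Alg.p X) f := by
  have hF : IsFamily X (Alg.s X) (Alg.p X) := Alg.isFamily hX
  have hsub (A : G.Fam) : Alg.p X (A.interY hfin)
      - ∑ᶠ (g : G.Edge) (_ : G.s g ∈ A.1 ∩ G.Y X), Alg.s X g * star (Alg.s X g)
      = gapSum (Alg.s X) (Alg.p X) (A.1 ∩ G.Y X) :=
    hF.p_sub_finsum_source (A.interY hfin) (finite_inter_Y hfin A.2)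
      (inter_subset_right.trans Y_subset_Reg)
  have h0 : gapSum (Alg.s X) (Alg.p X) (∅ : Set G.Vert) = 0 := finsum_mem_empty
  have hp (Z : (G.ext X).Fam) : Alg.p X Z.base - Alg.p X (Z.base.interY hfin)
      + (∑ᶠ (g : G.Edge) (_ : G.s g ∈ Z.base.1 ∩ G.Y X), Alg.s X g * star (Alg.s X g))
      + ∑ᶠ (a : G.Vert) (_ : a ∈ Z.top), Alg.q X a = extP (Alg.s X) (Alg.p X) Z := by
    rw [sub_add, hsub]
    rfl
  have hs (e : G.Edge) : Alg.s X e * (Alg.p X (Fam.range e) - Alg.p X ((Fam.range e).interY hfin)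
      + ∑ᶠ (g : G.Edge) (_ : G.s g ∈ G.r e ∩ G.Y X), Alg.s X g * star (Alg.s X g))
      = extS (Alg.s X) (Alg.p X) (baseEdge e : (G.ext X).Edge) := by
    have h1 := hsub (Fam.range e)
    change _ - ∑ᶠ (g : G.Edge) (_ : G.s g ∈ G.r e ∩ G.Y X), _ = _ at h1
    rw [sub_add, h1, extS, extP, Fam.base_range_inl, Fam.top_range_inl, h0, add_zero]
    rfl
  have hs' (e : {e : G.Edge // (G.r e ∩ G.Y X).Nonempty}) :
      Alg.s X e.1 * (Alg.p X ((Fam.range e.1).interY hfin)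
        - ∑ᶠ (g : G.Edge) (_ : G.s g ∈ G.r e.1 ∩ G.Y X), Alg.s X g * star (Alg.s X g))
      = extS (Alg.s X) (Alg.p X) (primeEdge e : (G.ext X).Edge) := by
    have h1 := hsub (Fam.range e.1)
    have h2 : (Fam.empty : G.Fam).1 ∩ G.Y X = ∅ := empty_inter _
    change _ - ∑ᶠ (g : G.Edge) (_ : G.s g ∈ G.r e.1 ∩ G.Y X), _ = _ at h1
    rw [h1, extS, extP, Fam.base_range_inr, Fam.top_range_inr, h2, h0, sub_zero, hF.p_empty,
      zero_add]
    rfl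
  constructor
  · intro h
    refine ⟨fun Z => (h.map_p Z).trans (hp Z), fun f => ?_⟩
    obtain ⟨e, rfl⟩ | ⟨e, rfl⟩ := edge_cases f
    · exact (h.map_s e).trans (hs e)
    · exact (h.map_s' e).trans (hs' e)
  · rintro ⟨h1, h2⟩
    exact ⟨fun Z => (h1 Z).trans (hp Z).symm, fun e => (h2 _).trans (hs e).symm,
      fun e => (h2 _).trans (hs' e).symm⟩

/-- `C*(G_X)` and `C*(G, X)` are isomorphic: the families `extS, extP` and `resS, resP` induce
mutually inverse *-homomorphisms. -/
theorem exists_iso (hX : X ⊆ G.Reg) (hfin : ∀ e, (G.r e ∩ G.Y X).Finite) :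
    ∃ (ψ : (G.ext X).Alg (G.ext X).Reg →⋆ₙₐ[ℂ] G.Alg X)
      (θ : G.Alg X →⋆ₙₐ[ℂ] (G.ext X).Alg (G.ext X).Reg),
      IsPsi hfin ψ ∧ (∀ A, θ (Alg.p X A) = resP hfin (Alg.p _) A) ∧
      (∀ e, θ (Alg.s X e) = resS (Alg.s _) e) ∧
      (∀ x, ψ (θ x) = x) ∧ ∀ z, θ (ψ z) = z := by
  have hF : IsFamily X (Alg.s X) (Alg.p X) := Alg.isFamily hX
  have hF' : IsFamily (G.ext X).Reg (Alg.s (G.ext X).Reg) (Alg.p (G.ext X).Reg) :=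
    Alg.isFamily subset_rfl
  obtain ⟨ψ, hψs, hψp⟩ := Alg.exists_lift subset_rfl (hF.extend hfin)
  obtain ⟨θ, hθs, hθp⟩ := Alg.exists_lift hX (hF'.restrict hfin hX)
  refine ⟨ψ, θ, (isPsi_iff hX hfin ψ).mpr ⟨hψp, hψs⟩, hθp, hθs, fun x => ?_, fun z => ?_⟩
  · have h : ψ.comp θ = NonUnitalStarAlgHom.id ℂ _ := by
      refine Alg.hom_ext (fun e => ?_) fun A => ?_
      · change ψ (θ _) = Alg.s X e
        rw [hθs, map_resS]
        simp only [hψs]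
        exact hF.extS_inl_add e
      · change ψ (θ _) = Alg.p X A
        rw [hθp, resP, hψp, IsFamily.extP_join hfin]
    exact DFunLike.congr_fun h x
  · have h : θ.comp ψ = NonUnitalStarAlgHom.id ℂ _ := by
      refine Alg.hom_ext (fun f => ?_) fun Z => ?_
      · change θ (ψ _) = Alg.s _ f
        rw [hψs, map_extS θ hfin]
        simp only [hθs, hθp]
        exact hF'.extS_res hfin f
      · change θ (ψ _) = Alg.p _ Z
        rw [hψp, map_extP θ hfin]
        simp only [hθs, hθp]
        exact hF'.extP_res hfin Z
    exact DFunLike.congr_fun h z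

end Ultragraph

namespace Ultragraph

/-! ### Weighted composition operators -/

section WeightedComp

variable {𝒳 : Type w} [MeasurableSpace 𝒳] {μ : Measure 𝒳}

lemma eLpNorm_two_sq (φ : 𝒳 → ℂ) : eLpNorm φ 2 μ ^ 2 = ∫⁻ x, ‖φ x‖ₑ ^ 2 ∂μ := by
  have h := eLpNorm_nnreal_pow_eq_lintegral (f := φ) (μ := μ) (p := 2) two_ne_zero
  norm_num at h
  exact_mod_cast h

lemma measurable_enorm_sq (φ : Lp ℂ 2 μ) : Measurable fun x => ‖φ x‖ₑ ^ 2 :=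
  (Lp.stronglyMeasurable φ).measurable.enorm.pow_const 2

lemma lintegral_enorm_sq_ne_top (φ : Lp ℂ 2 μ) : ∫⁻ x, ‖φ x‖ₑ ^ 2 ∂μ ≠ ∞ := by
  rw [← eLpNorm_two_sq]
  exact ENNReal.pow_ne_top (Lp.eLpNorm_ne_top φ)

/-- The function `w^{1/2} (φ ∘ g) χ_R`. -/
noncomputable def weightedComp (R : Set 𝒳) (g : 𝒳 → 𝒳) (w : 𝒳 → ℝ≥0∞) (φ : 𝒳 → ℂ) : 𝒳 → ℂ :=
  R.indicator fun x => ((Real.sqrt (w x).toReal : ℝ) : ℂ) * φ (g x)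

lemma enorm_sqrt_sq (t : ℝ≥0∞) :
    ‖((Real.sqrt t.toReal : ℝ) : ℂ)‖ₑ ^ 2 = ENNReal.ofReal t.toReal := by
  rw [← ofReal_norm, ← ENNReal.ofReal_pow (norm_nonneg _), Complex.norm_real, Real.norm_eq_abs,
    sq_abs, Real.sq_sqrt ENNReal.toReal_nonneg]

omit [MeasurableSpace 𝒳] in
lemma enorm_weightedComp_sq (R : Set 𝒳) (g : 𝒳 → 𝒳) (w : 𝒳 → ℝ≥0∞) (φ : 𝒳 → ℂ) (x : 𝒳) :
    ‖weightedComp R g w φ x‖ₑ ^ 2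
      = R.indicator (fun x => ENNReal.ofReal (w x).toReal * ‖φ (g x)‖ₑ ^ 2) x := by
  by_cases hx : x ∈ R
  · simp only [weightedComp, Set.indicator_of_mem hx, enorm_mul, mul_pow, enorm_sqrt_sq]
  · simp [weightedComp, hx]

variable {R : Set 𝒳} {g : 𝒳 → 𝒳} {w : 𝒳 → ℝ≥0∞}

/-- If the image under `g` of the measure with density `w` on `R` is at most `μ`, then
`φ ↦ w^{1/2} (φ ∘ g) χ_R` is a contraction of `L²(μ)`. -/
lemma exists_weightedComp (hR : MeasurableSet R) (hg : Measurable g) (hw : Measurable w)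
    (hle : ∀ u : 𝒳 → ℝ≥0∞, Measurable u →
      ∫⁻ x in R, w x * u (g x) ∂μ ≤ ∫⁻ x, u x ∂μ) :
    ∃ T : Lp ℂ 2 μ →L[ℂ] Lp ℂ 2 μ, ∀ φ : Lp ℂ 2 μ, T φ =ᵐ[μ] weightedComp R g w φ := by
  have hmeas (φ : Lp ℂ 2 μ) : AEStronglyMeasurable (weightedComp R g w φ) μ := by
    refine Measurable.aestronglyMeasurable (Measurable.indicator ?_ hR)
    exact (Complex.measurable_ofReal.comp hw.ennreal_toReal.sqrt).mul
      ((Lp.stronglyMeasurable φ).measurable.comp hg)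
  have hnorm (φ : Lp ℂ 2 μ) : eLpNorm (weightedComp R g w φ) 2 μ ≤ eLpNorm φ 2 μ := by
    rw [← ENNReal.pow_le_pow_left_iff two_ne_zero, eLpNorm_two_sq, eLpNorm_two_sq]
    refine le_trans ?_ (hle _ (measurable_enorm_sq φ))
    simp only [enorm_weightedComp_sq]
    rw [lintegral_indicator hR]
    exact lintegral_mono fun x => mul_le_mul_left ENNReal.ofReal_toReal_le _
  have hmem (φ : Lp ℂ 2 μ) : MemLp (weightedComp R g w φ) 2 μ :=
    ⟨hmeas φ, (hnorm φ).trans_lt (Lp.eLpNorm_lt_top φ)⟩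
  -- Changing `φ` on a null set `N` does not matter, as `w` vanishes almost everywhere on `g⁻¹(N)`.
  have hae (φ φ' : 𝒳 → ℂ) (h : φ =ᵐ[μ] φ') :
      weightedComp R g w φ =ᵐ[μ] weightedComp R g w φ' := by
    obtain ⟨N, hN, hNm, hN0⟩ := exists_measurable_superset_of_null (ae_iff.mp h)
    have h1 : ∫⁻ x in R, w x * N.indicator 1 (g x) ∂μ = 0 := by
      refine le_antisymm ((hle _ (measurable_one.indicator hNm)).trans ?_) zero_le
      rw [lintegral_indicator_one hNm, hN0]
    have h1' := (lintegral_eq_zero_iff (hw.mul ((measurable_one.indicator hNm).comp hg))).mp h1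
    filter_upwards [(ae_restrict_iff' hR).mp h1'] with x hx
    by_cases hxR : x ∈ R
    · simp only [weightedComp, Set.indicator_of_mem hxR]
      by_cases hxN : g x ∈ N
      · have h2 : w x = 0 := by simpa [hxN] using hx hxR
        simp [h2]
      · have h2 : φ (g x) = φ' (g x) := by
          by_contra h3
          exact hxN (hN h3)
        rw [h2]
    · simp [weightedComp, hxR]
  let T : Lp ℂ 2 μ →ₗ[ℂ] Lp ℂ 2 μ :=
    { toFun := fun φ => (hmem φ).toLp
      map_add' := fun φ φ' => by
        refine Lp.ext ?_
        refine ((hmem (φ + φ')).coeFn_toLp).trans ((hae _ _ (Lp.coeFn_add φ φ')).trans ?_)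
        filter_upwards [Lp.coeFn_add (hmem φ).toLp (hmem φ').toLp, (hmem φ).coeFn_toLp,
          (hmem φ').coeFn_toLp] with x h1 h2 h3
        rw [h1, Pi.add_apply, h2, h3]
        by_cases hx : x ∈ R <;> simp [weightedComp, hx, mul_add]
      map_smul' := fun c φ => by
        refine Lp.ext ?_
        refine ((hmem (c • φ)).coeFn_toLp).trans ((hae _ _ (Lp.coeFn_smul c φ)).trans ?_)
        filter_upwards [Lp.coeFn_smul c (hmem φ).toLp, (hmem φ).coeFn_toLp] with x h1 h2
        rw [RingHom.id_apply, h1, Pi.smul_apply, h2]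
        by_cases hx : x ∈ R <;> simp [weightedComp, hx, mul_left_comm] }
  refine ⟨T.mkContinuous 1 fun φ => ?_, fun φ => (hmem φ).coeFn_toLp⟩
  rw [one_mul, Lp.norm_def, Lp.norm_def]
  refine ENNReal.toReal_mono (Lp.eLpNorm_ne_top φ) ?_
  exact (eLpNorm_congr_ae (hmem φ).coeFn_toLp).trans_le (hnorm φ)

lemma op_ext {T T' : Lp ℂ 2 μ →L[ℂ] Lp ℂ 2 μ} (h : ∀ φ, (T φ : 𝒳 → ℂ) =ᵐ[μ] T' φ) : T = T' :=
  ContinuousLinearMap.ext fun φ => Lp.ext (h φ)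

lemma exists_indicatorOp (μ : Measure 𝒳) {D : Set 𝒳} (hD : MeasurableSet D) :
    ∃ T : Lp ℂ 2 μ →L[ℂ] Lp ℂ 2 μ, ∀ φ : Lp ℂ 2 μ, T φ =ᵐ[μ] D.indicator φ := by
  obtain ⟨T, hT⟩ := exists_weightedComp (μ := μ) hD measurable_id (measurable_const (a := 1))
    fun u _ => by
      simp only [one_mul, id]
      exact setLIntegral_le_lintegral _ _
  refine ⟨T, fun φ => (hT φ).trans (Filter.Eventually.of_forall fun x => ?_)⟩
  simp [weightedComp]

/-- The multiplication by the indicator function of a measurable set. -/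
noncomputable def indicatorOp (μ : Measure 𝒳) {D : Set 𝒳} (hD : MeasurableSet D) :
    Lp ℂ 2 μ →L[ℂ] Lp ℂ 2 μ := (exists_indicatorOp μ hD).choose

lemma indicatorOp_apply {D : Set 𝒳} (hD : MeasurableSet D) (φ : Lp ℂ 2 μ) :
    indicatorOp μ hD φ =ᵐ[μ] D.indicator φ := (exists_indicatorOp μ hD).choose_spec φ

variable {D E F : Set 𝒳} (hD : MeasurableSet D) (hE : MeasurableSet E) (hF : MeasurableSet F)

include hD hE in
lemma indicatorOp_congr (h : D =ᵐ[μ] E) : indicatorOp μ hD = indicatorOp μ hE :=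
  op_ext fun φ => (indicatorOp_apply hD φ).trans
    ((indicator_ae_eq_of_ae_eq_set h).trans (indicatorOp_apply hE φ).symm)

lemma indicatorOp_empty (h : D =ᵐ[μ] (∅ : Set 𝒳)) : indicatorOp μ hD = 0 :=
  op_ext fun φ => by
    refine (indicatorOp_apply hD φ).trans ((indicator_ae_eq_of_ae_eq_set h).trans ?_)
    rw [indicator_empty]
    exact (Lp.coeFn_zero _ _ _).symm

lemma indicatorOp_mul : indicatorOp μ hD * indicatorOp μ hE = indicatorOp μ (hD.inter hE) :=
  op_ext fun φ => by
    filter_upwards [indicatorOp_apply hD (indicatorOp μ hE φ), indicatorOp_apply hE φ,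
      indicatorOp_apply (hD.inter hE) φ] with x h1 h2 h3
    rw [mul_apply_eq_comp, h1, h3]
    by_cases hx : x ∈ D <;> by_cases hx' : x ∈ E <;> simp [hx, hx', h2]

lemma indicatorOp_union_add_inter : indicatorOp μ (hD.union hE) =
    indicatorOp μ hD + indicatorOp μ hE - indicatorOp μ (hD.inter hE) :=
  op_ext fun φ => by
    filter_upwards [indicatorOp_apply (hD.union hE) φ, indicatorOp_apply hD φ,
      indicatorOp_apply hE φ, indicatorOp_apply (hD.inter hE) φ,
      Lp.coeFn_sub ((indicatorOp μ hD + indicatorOp μ hE) φ) (indicatorOp μ (hD.inter hE) φ),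
      Lp.coeFn_add (indicatorOp μ hD φ) (indicatorOp μ hE φ)] with x h1 h2 h3 h4 h5 h6
    change _ =
      ((indicatorOp μ hD + indicatorOp μ hE) φ - indicatorOp μ (hD.inter hE) φ : Lp ℂ 2 μ) x
    rw [h5, Pi.sub_apply]
    change _ = (indicatorOp μ hD φ + indicatorOp μ hE φ : Lp ℂ 2 μ) x - _
    rw [h6, Pi.add_apply, h1, h2, h3, h4]
    by_cases hx : x ∈ D <;> by_cases hx' : x ∈ E <;> simp [hx, hx']

lemma star_indicatorOp : star (indicatorOp μ hD) = indicatorOp μ hD := by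
  rw [ContinuousLinearMap.star_eq_adjoint, eq_comm, ContinuousLinearMap.eq_adjoint_iff]
  intro φ φ'
  rw [L2.inner_def, L2.inner_def]
  refine integral_congr_ae ?_
  filter_upwards [indicatorOp_apply hD φ, indicatorOp_apply hD φ'] with x h1 h2
  rw [h1, h2]
  by_cases hx : x ∈ D <;> simp [hx]

lemma star_mul_self_eq_of_norm_eq {T T' : Lp ℂ 2 μ →L[ℂ] Lp ℂ 2 μ}
    (h : ∀ φ, ‖T φ‖ = ‖T' φ‖) : star T * T = star T' * T' := by
  have h1 : ((star T * T : Lp ℂ 2 μ →L[ℂ] Lp ℂ 2 μ) : Lp ℂ 2 μ →ₗ[ℂ] Lp ℂ 2 μ)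
      = (star T' * T' : Lp ℂ 2 μ →L[ℂ] Lp ℂ 2 μ) := by
    rw [← ext_inner_map]
    intro φ
    simp only [ContinuousLinearMap.coe_coe, mul_apply_eq_comp,
      ContinuousLinearMap.star_eq_adjoint, ContinuousLinearMap.adjoint_inner_left,
      inner_self_eq_norm_sq_to_K, h]
  exact ContinuousLinearMap.coe_injective h1

end WeightedComp

end Ultragraph

namespace Ultragraph

/-! ### Representations induced by branching systems -/

namespace BranchingData.IsRelBranchingSystem

variable {G : Ultragraph.{u, v}} {X : Set G.Vert} {𝒳 : Type w} [MeasurableSpace 𝒳]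
  {μ : Measure 𝒳} {S : BranchingData G 𝒳} (hS : S.IsRelBranchingSystem X μ)
include hS

lemma setLIntegral_comp_finv (e : G.Edge) {u : 𝒳 → ℝ≥0∞} (hu : Measurable u) :
    ∫⁻ x in S.R e, u (S.finv e x) ∂μ = ∫⁻ x in S.D (Fam.range e), S.Φ e x * u x ∂μ := by
  rw [← lintegral_map hu (hS.measurable_finv e), hS.rnDeriv_f,
    lintegral_withDensity_eq_lintegral_mul _ (hS.measurable_Φ e) hu]
  rfl

lemma setLIntegral_comp_f (e : G.Edge) {u : 𝒳 → ℝ≥0∞} (hu : Measurable u) :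
    ∫⁻ x in S.D (Fam.range e), u (S.f e x) ∂μ = ∫⁻ x in S.R e, S.Φinv e x * u x ∂μ := by
  rw [← lintegral_map hu (hS.measurable_f e), hS.rnDeriv_finv,
    lintegral_withDensity_eq_lintegral_mul _ (hS.measurable_Φinv e) hu]
  rfl

/-- The map `f_e⁻¹` pulls null sets back to null sets. -/
lemma ae_comp_finv (e : G.Edge) {p : 𝒳 → Prop} (hp : ∀ᵐ x ∂μ, p x) :
    ∀ᵐ y ∂μ, y ∈ S.R e → p (S.finv e y) := by
  rw [← ae_restrict_iff' (hS.measurableSet_R e)]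
  refine ae_of_ae_map (hS.measurable_finv e).aemeasurable ?_
  rw [hS.rnDeriv_f]
  exact (withDensity_absolutelyContinuous _ _).ae_le (ae_restrict_of_ae hp)

lemma setLIntegral_Φinv_mul (e : G.Edge) {u : 𝒳 → ℝ≥0∞} (hu : Measurable u) :
    ∫⁻ x in S.R e, S.Φinv e x * u (S.finv e x) ∂μ = ∫⁻ x in S.D (Fam.range e), u x ∂μ := by
  refine (hS.setLIntegral_comp_f e (hu.comp (hS.measurable_finv e))).symm.trans ?_
  refine setLIntegral_congr_fun_ae (hS.measurableSet_D _) ?_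
  filter_upwards [hS.finv_f e] with x hx hxD
  simp only [Function.comp_apply, hx hxD]

lemma setLIntegral_Φ_mul (e : G.Edge) {u : 𝒳 → ℝ≥0∞} (hu : Measurable u) :
    ∫⁻ x in S.D (Fam.range e), S.Φ e x * u (S.f e x) ∂μ = ∫⁻ x in S.R e, u x ∂μ := by
  refine (hS.setLIntegral_comp_finv e (hu.comp (hS.measurable_f e))).symm.trans ?_
  refine setLIntegral_congr_fun_ae (hS.measurableSet_R _) ?_
  filter_upwards [hS.f_finv e] with x hx hxR
  simp only [Function.comp_apply, hx hxR]

/-- The densities of `f_e` and `f_e⁻¹` are reciprocal on the support of an integrable function.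
As `μ` need not be `σ`-finite, they may fail to be so elsewhere. -/
lemma Φinv_mul_Φ_eq_one (e : G.Edge) {u : 𝒳 → ℝ≥0∞} (hu : Measurable u)
    (hi : ∫⁻ x, u x ∂μ ≠ ∞) (hu' : ∀ x, u x ≠ ∞) :
    ∀ᵐ y ∂μ, y ∈ S.R e → u y ≠ 0 → S.Φinv e y * S.Φ e (S.finv e y) = 1 := by
  have hv : Measurable fun y => S.Φinv e y * S.Φ e (S.finv e y) * u y :=
    ((hS.measurable_Φinv e).mul ((hS.measurable_Φ e).comp (hS.measurable_finv e))).mul hu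
  have key (t : 𝒳 → ℝ≥0∞) (ht : Measurable t) : ∫⁻ x in S.R e, t x ∂μ
      = ∫⁻ x in S.R e, S.Φinv e x * (S.Φ e (S.finv e x) * t x) ∂μ := by
    rw [← hS.setLIntegral_Φ_mul e ht]
    refine Eq.trans ?_ (hS.setLIntegral_comp_f e
      (((hS.measurable_Φ e).comp (hS.measurable_finv e)).mul ht))
    refine setLIntegral_congr_fun_ae (hS.measurableSet_D _) ?_
    filter_upwards [hS.finv_f e] with x hx hxD
    simp only [hx hxD]
  have h1 : (μ.restrict (S.R e)).withDensity u
      = (μ.restrict (S.R e)).withDensity fun y => S.Φinv e y * S.Φ e (S.finv e y) * u y := by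
    ext E hE
    rw [withDensity_apply _ hE, withDensity_apply _ hE, ← lintegral_indicator hE,
      ← lintegral_indicator hE, key _ (hu.indicator hE)]
    refine lintegral_congr fun x => ?_
    by_cases hx : x ∈ E <;> simp [hx, mul_assoc]
  have h2 := (withDensity_eq_iff hu.aemeasurable hv.aemeasurable
    (ne_top_of_le_ne_top hi (setLIntegral_le_lintegral _ _))).mp h1
  filter_upwards [(ae_restrict_iff' (hS.measurableSet_R e)).mp h2] with y hy hyR hy0
  have h3 := hy hyR
  rwa [eq_comm, ENNReal.mul_eq_right hy0 (hu' y)] at h3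

lemma exists_edgeOp (e : G.Edge) : ∃ T : Lp ℂ 2 μ →L[ℂ] Lp ℂ 2 μ, ∀ φ : Lp ℂ 2 μ,
    T φ =ᵐ[μ] weightedComp (S.R e) (S.finv e) (S.Φinv e) φ :=
  exists_weightedComp (hS.measurableSet_R e) (hS.measurable_finv e) (hS.measurable_Φinv e)
    fun u hu => by
      rw [hS.setLIntegral_Φinv_mul e hu]
      exact setLIntegral_le_lintegral _ _

/-- The operator `φ ↦ Φ_{f_e⁻¹}^{1/2} (φ ∘ f_e⁻¹) χ_{R_e}`. -/
noncomputable def edgeOp (e : G.Edge) : Lp ℂ 2 μ →L[ℂ] Lp ℂ 2 μ := (hS.exists_edgeOp e).choose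

lemma edgeOp_apply (e : G.Edge) (φ : Lp ℂ 2 μ) :
    hS.edgeOp e φ =ᵐ[μ] weightedComp (S.R e) (S.finv e) (S.Φinv e) φ :=
  (hS.exists_edgeOp e).choose_spec φ

lemma norm_edgeOp_apply (e : G.Edge) (φ : Lp ℂ 2 μ) :
    ‖hS.edgeOp e φ‖ = ‖indicatorOp μ (hS.measurableSet_D (Fam.range e)) φ‖ := by
  have hm := measurable_enorm_sq φ
  have h1 := hS.setLIntegral_Φinv_mul e hm
  have h2 : ∫⁻ x in S.R e, S.Φinv e x * ‖φ (S.finv e x)‖ₑ ^ 2 ∂μ ≠ ∞ := by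
    rw [h1]
    exact ne_top_of_le_ne_top (lintegral_enorm_sq_ne_top φ) (setLIntegral_le_lintegral _ _)
  -- Where the density is infinite, `φ ∘ f_e⁻¹` vanishes, so that `toReal` does no harm.
  have h3 : ∀ᵐ x ∂μ.restrict (S.R e), ENNReal.ofReal (S.Φinv e x).toReal * ‖φ (S.finv e x)‖ₑ ^ 2
      = S.Φinv e x * ‖φ (S.finv e x)‖ₑ ^ 2 := by
    filter_upwards [ae_lt_top ((hS.measurable_Φinv e).mul
      (hm.comp (hS.measurable_finv e))) h2] with x hx
    by_cases ht : S.Φinv e x = ∞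
    · have h4 : ‖φ (S.finv e x)‖ₑ ^ 2 = 0 := by
        by_contra h5
        simp only [Pi.mul_apply, ht, Function.comp_apply, ENNReal.top_mul h5, lt_self_iff_false]
          at hx
      rw [h4, mul_zero, mul_zero]
    · rw [ENNReal.ofReal_toReal ht]
  rw [Lp.norm_def, Lp.norm_def]
  congr 1
  refine (ENNReal.pow_right_strictMono two_ne_zero).injective ?_
  rw [eLpNorm_congr_ae (hS.edgeOp_apply e φ), eLpNorm_congr_ae (indicatorOp_apply _ φ),
    eLpNorm_two_sq, eLpNorm_two_sq]
  simp only [enorm_weightedComp_sq]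
  rw [lintegral_indicator (hS.measurableSet_R e), lintegral_congr_ae h3, h1,
    ← lintegral_indicator (hS.measurableSet_D _)]
  refine lintegral_congr fun x => ?_
  by_cases hx : x ∈ S.D (Fam.range e) <;> simp [hx]

lemma star_edgeOp_mul_self (e : G.Edge) : star (hS.edgeOp e) * hS.edgeOp e
    = indicatorOp μ (hS.measurableSet_D (Fam.range e)) := by
  rw [star_mul_self_eq_of_norm_eq (hS.norm_edgeOp_apply e), star_indicatorOp, indicatorOp_mul]
  exact indicatorOp_congr _ _ (Filter.EventuallyEq.of_eq (inter_self _))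

lemma indicatorOp_mul_edgeOp (e : G.Edge) {E : Set 𝒳} (hE : MeasurableSet E)
    (h : S.R e ≤ᵐ[μ] E) : indicatorOp μ hE * hS.edgeOp e = hS.edgeOp e :=
  op_ext fun φ => by
    filter_upwards [indicatorOp_apply hE (hS.edgeOp e φ), hS.edgeOp_apply e φ, h] with x h1 h2 h3
    rw [mul_apply_eq_comp, h1]
    by_cases hx : x ∈ E
    · rw [indicator_of_mem hx]
    · have hxR : x ∉ S.R e := fun hxR => hx (h3 hxR)
      rw [indicator_of_notMem hx, h2, weightedComp, indicator_of_notMem hxR]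

lemma edgeOp_mul_indicatorOp (e : G.Edge) :
    hS.edgeOp e * indicatorOp μ (hS.measurableSet_D (Fam.range e)) = hS.edgeOp e :=
  op_ext fun φ => by
    filter_upwards [hS.edgeOp_apply e (indicatorOp μ (hS.measurableSet_D (Fam.range e)) φ),
      hS.edgeOp_apply e φ,
      hS.ae_comp_finv e (indicatorOp_apply (hS.measurableSet_D (Fam.range e)) φ),
      hS.finv_mem e] with x h1 h2 h3 h4
    rw [mul_apply_eq_comp, h1, h2]
    by_cases hx : x ∈ S.R e
    · rw [weightedComp, weightedComp, indicator_of_mem hx, indicator_of_mem hx, h3 hx,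
        indicator_of_mem (h4 hx)]
    · rw [weightedComp, weightedComp, indicator_of_notMem hx, indicator_of_notMem hx]

/-- The range of the operator of an edge contains `L²(R_e)`: a preimage of `ψ` is
`Φ_{f_e}^{1/2} (ψ ∘ f_e) χ_{D_{r(e)}}`. -/
lemma exists_edgeOp_eq (e : G.Edge) (ψ : Lp ℂ 2 μ) :
    ∃ φ, hS.edgeOp e φ = indicatorOp μ (hS.measurableSet_R e) ψ := by
  obtain ⟨T, hT⟩ := exists_weightedComp (μ := μ) (hS.measurableSet_D (Fam.range e))
    (hS.measurable_f e) (hS.measurable_Φ e) fun u hu => by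
      rw [hS.setLIntegral_Φ_mul e hu]
      exact setLIntegral_le_lintegral _ _
  refine ⟨T ψ, Lp.ext ?_⟩
  filter_upwards [hS.edgeOp_apply e (T ψ), indicatorOp_apply (hS.measurableSet_R e) ψ,
    hS.ae_comp_finv e (hT ψ), hS.finv_mem e, hS.f_finv e,
    hS.Φinv_mul_Φ_eq_one e (measurable_enorm_sq ψ) (lintegral_enorm_sq_ne_top ψ)
      (fun x => ENNReal.pow_ne_top enorm_ne_top)] with x h1 h2 h3 h4 h5 h6
  rw [h1, h2]
  by_cases hx : x ∈ S.R e
  · rw [weightedComp, indicator_of_mem hx, indicator_of_mem hx, h3 hx, weightedComp,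
      indicator_of_mem (h4 hx), h5 hx]
    by_cases h0 : ψ x = 0
    · rw [h0, mul_zero, mul_zero]
    · have h7 := congrArg ENNReal.toReal (h6 hx (pow_ne_zero 2 (enorm_ne_zero.mpr h0)))
      rw [ENNReal.toReal_mul, ENNReal.toReal_one] at h7
      rw [← mul_assoc, ← Complex.ofReal_mul, ← Real.sqrt_mul ENNReal.toReal_nonneg, h7,
        Real.sqrt_one, Complex.ofReal_one, one_mul]
  · rw [weightedComp, indicator_of_notMem hx, indicator_of_notMem hx]

lemma edgeOp_mul_star (e : G.Edge) :
    hS.edgeOp e * star (hS.edgeOp e) = indicatorOp μ (hS.measurableSet_R e) := by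
  have h1 : hS.edgeOp e * star (hS.edgeOp e) * indicatorOp μ (hS.measurableSet_R e)
      = indicatorOp μ (hS.measurableSet_R e) := by
    ext1 ψ
    obtain ⟨φ, hφ⟩ := hS.exists_edgeOp_eq e ψ
    rw [mul_apply_eq_comp, ← hφ, ← mul_apply_eq_comp, mul_assoc, hS.star_edgeOp_mul_self,
      hS.edgeOp_mul_indicatorOp]
  have h2 := congrArg star h1
  rwa [star_mul, star_mul, star_star, star_indicatorOp, ← mul_assoc,
    hS.indicatorOp_mul_edgeOp e _ Filter.EventuallyLE.rfl] at h2

lemma finsum_indicatorOp_R {F : Set G.Edge} (hF : F.Finite)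
    (hm : MeasurableSet (⋃ e ∈ F, S.R e)) :
    ∑ᶠ e ∈ F, indicatorOp μ (hS.measurableSet_R e) = indicatorOp μ hm := by
  induction F, hF using Set.Finite.induction_on with
  | empty =>
    rw [finsum_mem_empty, indicatorOp_empty]
    simp
  | @insert a F ha hF ih =>
    have hm' : MeasurableSet (⋃ e ∈ F, S.R e) :=
      hF.measurableSet_biUnion fun e _ => hS.measurableSet_R e
    have h1 : (S.R a ∩ ⋃ e ∈ F, S.R e : Set 𝒳) =ᵐ[μ] (∅ : Set 𝒳) := by
      rw [inter_iUnion₂, ae_eq_empty, measure_biUnion_null_iff hF.countable]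
      intro e he
      rw [← ae_eq_empty]
      exact hS.R_disjoint a e fun h => ha (h ▸ he)
    rw [finsum_mem_insert _ ha hF, ih hm']
    have h2 := indicatorOp_union_add_inter (μ := μ) (hS.measurableSet_R a) hm'
    rw [indicatorOp_empty _ h1, sub_zero] at h2
    rw [← h2]
    exact indicatorOp_congr _ _ (Filter.EventuallyEq.of_eq (biUnion_insert _ _ _).symm)

/-- The operators of a branching system satisfy the defining relations. -/
lemma isFamily (hX : X ⊆ G.Reg) :
    IsFamily X hS.edgeOp fun A => indicatorOp μ (hS.measurableSet_D A) where
  p_star A := star_indicatorOp _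
  p_inter A A' := (indicatorOp_mul _ _).trans (indicatorOp_congr _ _ (hS.D_inter A A'))
  p_empty := indicatorOp_empty _ (Filter.EventuallyEq.of_eq hS.D_empty)
  p_union A A' := by
    rw [← indicatorOp_congr ((hS.measurableSet_D A).union (hS.measurableSet_D A')) _
      (hS.D_union A A'), ← indicatorOp_congr
      ((hS.measurableSet_D A).inter (hS.measurableSet_D A')) _ (hS.D_inter A A'),
      indicatorOp_union_add_inter]
  s_orthogonal e e' he := by
    have h1 := hS.indicatorOp_mul_edgeOp e (hS.measurableSet_R e) Filter.EventuallyLE.rfl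
    have h2 := hS.indicatorOp_mul_edgeOp e' (hS.measurableSet_R e') Filter.EventuallyLE.rfl
    rw [← h1, ← h2, star_mul, star_indicatorOp, mul_assoc, ← mul_assoc (indicatorOp μ _),
      indicatorOp_mul, indicatorOp_empty _ (hS.R_disjoint e e' he), zero_mul, mul_zero]
  s_source e := hS.star_edgeOp_mul_self e
  mul_range e := hS.edgeOp_mul_indicatorOp e
  source_mul e := hS.indicatorOp_mul_edgeOp e _ (hS.R_subset e)
  cuntzKrieger a ha := by
    have hm : MeasurableSet (⋃ e ∈ {e | G.s e = a}, S.R e) :=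
      (hX ha).2.measurableSet_biUnion fun e _ => hS.measurableSet_R e
    simp only [hS.edgeOp_mul_star]
    refine Eq.trans ?_ (hS.finsum_indicatorOp_R (hX ha).2 hm).symm
    exact indicatorOp_congr _ _ (hS.D_vert a ha)

/-- A branching system induces one and only one representation. -/
theorem exists_unique_induces (hX : X ⊆ G.Reg) :
    ∃ η : G.Alg X →⋆ₙₐ[ℂ] (Lp ℂ 2 μ →L[ℂ] Lp ℂ 2 μ), ∀ η', S.Induces X μ η' ↔ η' = η := by
  obtain ⟨η, hs, hp⟩ := Alg.exists_lift hX (hS.isFamily hX)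
  have hη : S.Induces X μ η :=
    ⟨fun e φ => by rw [hs]; exact hS.edgeOp_apply e φ,
      fun A φ => by rw [hp]; exact indicatorOp_apply _ φ⟩
  refine ⟨η, fun η' => ⟨fun h => Alg.hom_ext (fun e => ?_) fun A => ?_, fun h => h ▸ hη⟩⟩
  · exact op_ext fun φ => (h.map_s e φ).trans (hη.map_s e φ).symm
  · exact op_ext fun φ => (h.map_p A φ).trans (hη.map_p A φ).symm

end BranchingData.IsRelBranchingSystem

end Ultragraph

namespace Ultragraph

variable {G : Ultragraph.{u, v}} {X : Set G.Vert}

/-! ### The lifted branching system -/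

instance : Countable G.Vert := G.countable_vert

instance : Countable G.Edge := G.countable_edge

/-- The vertex sets that need at most `n` rounds of unions and intersections. -/
def genStage (G : Ultragraph.{u, v}) : ℕ → Set (Set G.Vert)
  | 0 => {∅} ∪ Set.range (fun a => {a}) ∪ Set.range G.r
  | n + 1 => genStage G n ∪ (Set.image2 (· ∪ ·) (genStage G n) (genStage G n) ∪
      Set.image2 (· ∩ ·) (genStage G n) (genStage G n))

lemma countable_genStage (n : ℕ) : (genStage G n).Countable := by
  induction n with
  | zero => exact ((countable_singleton _).union (countable_range _)).union (countable_range _)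
  | succ n ih => exact ih.union ((ih.image2 ih _).union (ih.image2 ih _))

lemma exists_mem_genStage {A : Set G.Vert} (hA : G.IsGen A) : ∃ n, A ∈ genStage G n := by
  have hmono : Monotone (genStage G) := monotone_nat_of_le_succ fun n => subset_union_left
  induction hA with
  | empty => exact ⟨0, Or.inl (Or.inl rfl)⟩
  | singleton a => exact ⟨0, Or.inl (Or.inr ⟨a, rfl⟩)⟩
  | range e => exact ⟨0, Or.inr ⟨e, rfl⟩⟩
  | union _ _ h1 h2 =>
    obtain ⟨m, hm⟩ := h1
    obtain ⟨n, hn⟩ := h2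
    exact ⟨max m n + 1, Or.inr (Or.inl ⟨_, hmono (le_max_left m n) hm, _,
      hmono (le_max_right m n) hn, rfl⟩)⟩
  | inter _ _ h1 h2 =>
    obtain ⟨m, hm⟩ := h1
    obtain ⟨n, hn⟩ := h2
    exact ⟨max m n + 1, Or.inr (Or.inr ⟨_, hmono (le_max_left m n) hm, _,
      hmono (le_max_right m n) hn, rfl⟩)⟩

instance : Countable G.Fam := by
  have h : {A : Set G.Vert | G.IsGen A} ⊆ ⋃ n, genStage G n := fun A hA =>
    mem_iUnion.mpr (exists_mem_genStage hA)
  exact ((countable_iUnion countable_genStage).mono h).to_subtype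

namespace BranchingData

variable {𝒳 : Type w} {S : BranchingData G 𝒳} {x : 𝒳}

section Lift

variable (S) (hfin : ∀ e, (G.r e ∩ G.Y X).Finite)

lemma lift_f (f : (G.ext X).Edge) : (S.lift hfin).f f = S.f (origin f) := by
  rcases f with e | e <;> rfl

lemma lift_finv (f : (G.ext X).Edge) : (S.lift hfin).finv f = S.finv (origin f) := by
  rcases f with e | e <;> rfl

lemma lift_Φ (f : (G.ext X).Edge) : (S.lift hfin).Φ f = S.Φ (origin f) := by
  rcases f with e | e <;> rfl

lemma lift_Φinv (f : (G.ext X).Edge) : (S.lift hfin).Φinv f = S.Φinv (origin f) := by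
  rcases f with e | e <;> rfl

end Lift

/-- A point at which the relations between the sets of a relative branching system hold. -/
structure IsGeneric (S : BranchingData G 𝒳) (X : Set G.Vert) (x : 𝒳) : Prop where
  not_mem_empty : x ∉ S.D Fam.empty
  inter (A B : G.Fam) : x ∈ S.D (A.inter B) ↔ x ∈ S.D A ∧ x ∈ S.D B
  union (A B : G.Fam) : x ∈ S.D (A.union B) ↔ x ∈ S.D A ∨ x ∈ S.D B
  R_unique (e e' : G.Edge) : x ∈ S.R e → x ∈ S.R e' → e = e'
  R_subset (e : G.Edge) : x ∈ S.R e → x ∈ S.D (Fam.vert (G.s e))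
  D_vert (a : G.Vert) : a ∈ X → x ∈ S.D (Fam.vert a) → ∃ e, G.s e = a ∧ x ∈ S.R e

/-- As there are only countably many edges and vertex sets, almost all points are generic. -/
lemma IsRelBranchingSystem.ae_isGeneric [MeasurableSpace 𝒳] {μ : Measure 𝒳}
    (hS : S.IsRelBranchingSystem X μ) : ∀ᵐ x ∂μ, S.IsGeneric X x := by
  have h1 : ∀ᵐ x ∂μ, ∀ A B : G.Fam, x ∈ S.D (A.inter B) ↔ x ∈ S.D A ∧ x ∈ S.D B :=
    ae_all_iff.mpr fun A => ae_all_iff.mpr fun B => (hS.D_inter A B).symm.mem_iff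
  have h2 : ∀ᵐ x ∂μ, ∀ A B : G.Fam, x ∈ S.D (A.union B) ↔ x ∈ S.D A ∨ x ∈ S.D B :=
    ae_all_iff.mpr fun A => ae_all_iff.mpr fun B => (hS.D_union A B).symm.mem_iff
  have h3 : ∀ᵐ x ∂μ, ∀ e e', x ∈ S.R e → x ∈ S.R e' → e = e' := by
    refine ae_all_iff.mpr fun e => ae_all_iff.mpr fun e' => ?_
    by_cases he : e = e'
    · exact Filter.Eventually.of_forall fun _ _ _ => he
    · filter_upwards [(hS.R_disjoint e e' he).mem_iff] with x hx h h'
      exact (hx.mp ⟨h, h'⟩).elim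
  have h4 : ∀ᵐ x ∂μ, ∀ e, x ∈ S.R e → x ∈ S.D (Fam.vert (G.s e)) :=
    ae_all_iff.mpr fun e => hS.R_subset e
  have h5 : ∀ᵐ x ∂μ, ∀ a, a ∈ X → x ∈ S.D (Fam.vert a) → ∃ e, G.s e = a ∧ x ∈ S.R e := by
    refine ae_all_iff.mpr fun a => ?_
    by_cases ha : a ∈ X
    · filter_upwards [(hS.D_vert a ha).mem_iff] with x hx _ h
      simpa using hx.mp h
    · exact Filter.Eventually.of_forall fun _ h => absurd h ha
  filter_upwards [h1, h2, h3, h4, h5] with x h1 h2 h3 h4 h5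
  exact ⟨by simp [hS.D_empty], h1, h2, h3, h4, h5⟩

namespace IsGeneric

variable (hx : S.IsGeneric X x)
include hx

lemma mem_D_iff {a : G.Vert} (ha : x ∈ S.D (Fam.vert a)) (A : G.Fam) : x ∈ S.D A ↔ a ∈ A.1 := by
  have h1 := hx.inter A (Fam.vert a)
  rw [and_iff_left ha] at h1
  rw [← h1]
  by_cases haA : a ∈ A.1
  · have h2 : A.inter (Fam.vert a) = Fam.vert a :=
      Subtype.ext (Set.inter_eq_right.mpr (Set.singleton_subset_iff.mpr haA))
    rw [h2]
    exact iff_of_true ha haA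
  · have h2 : A.inter (Fam.vert a) = Fam.empty :=
      Subtype.ext (Set.inter_singleton_eq_empty.mpr haA)
    rw [h2]
    exact iff_of_false hx.not_mem_empty haA

lemma eq_of_mem_vert {a b : G.Vert} (ha : x ∈ S.D (Fam.vert a)) (hb : x ∈ S.D (Fam.vert b)) :
    a = b := (hx.mem_D_iff ha (Fam.vert b)).mp hb

lemma exists_vert {A : G.Fam} (hA : A.1.Finite) (h : x ∈ S.D A) :
    ∃ a ∈ A.1, x ∈ S.D (Fam.vert a) := by
  obtain ⟨A, hgen⟩ := A
  change A.Finite at hA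
  induction A, hA using Set.Finite.induction_on with
  | empty => exact (hx.not_mem_empty h).elim
  | @insert a A _ hA ih =>
    rcases (hx.union (Fam.vert a) ⟨A, isGen_of_finite hA⟩).mp h with h1 | h1
    · exact ⟨a, mem_insert _ _, h1⟩
    · obtain ⟨b, hb, hb'⟩ := ih _ h1
      exact ⟨b, mem_insert_of_mem _ hb, hb'⟩

variable (hfin : ∀ e, (G.r e ∩ G.Y X).Finite) (Z : (G.ext X).Fam)

lemma mem_lift_D_of_not_mem (h : ∀ a ∈ G.Y X, x ∉ S.D (Fam.vert a)) :
    x ∈ (S.lift hfin).D Z ↔ x ∈ S.D Z.base := by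
  constructor
  · rintro ((h1 | h1) | h1)
    · exact h1.1
    · obtain ⟨g, hg, hxg⟩ := mem_iUnion₂.mp h1
      exact absurd (hx.R_subset g hxg) (h _ hg.2)
    · obtain ⟨a, ha, hxa⟩ := mem_iUnion₂.mp h1
      exact absurd hxa.1 (h a (Z.top_subset_Y ha))
  · refine fun h1 => Or.inl (Or.inl ⟨h1, fun h2 => ?_⟩)
    obtain ⟨a, ha, hxa⟩ := hx.exists_vert (finite_inter_Y hfin Z.base.2) h2
    exact h a ha.2 hxa

lemma mem_lift_D_of_mem_R {g : G.Edge} (hg : G.s g ∈ G.Y X) (hxg : x ∈ S.R g) :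
    x ∈ (S.lift hfin).D Z ↔ G.s g ∈ Z.base.1 := by
  have hxs := hx.R_subset g hxg
  constructor
  · rintro ((h1 | h1) | h1)
    · exact (hx.mem_D_iff hxs _).mp h1.1
    · obtain ⟨g', hg', hxg'⟩ := mem_iUnion₂.mp h1
      rw [hx.R_unique g g' hxg hxg']
      exact hg'.1
    · obtain ⟨a, _, hxa⟩ := mem_iUnion₂.mp h1
      refine absurd (mem_iUnion₂.mpr ⟨g, ?_, hxg⟩) hxa.2
      exact hx.eq_of_mem_vert hxs hxa.1
  · exact fun h1 => Or.inl (Or.inr (mem_iUnion₂.mpr ⟨g, ⟨h1, hg⟩, hxg⟩))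

lemma mem_lift_D_of_defect {a : G.Vert} (ha : a ∈ G.Y X) (hxa : x ∈ S.defect a) :
    x ∈ (S.lift hfin).D Z ↔ a ∈ Z.top := by
  constructor
  · rintro ((h1 | h1) | h1)
    · refine absurd ((hx.mem_D_iff hxa.1 (Z.base.interY hfin)).mpr ⟨?_, ha⟩) h1.2
      exact (hx.mem_D_iff hxa.1 _).mp h1.1
    · obtain ⟨g, _, hxg⟩ := mem_iUnion₂.mp h1
      refine absurd (mem_iUnion₂.mpr ⟨g, ?_, hxg⟩) hxa.2
      exact hx.eq_of_mem_vert (hx.R_subset g hxg) hxa.1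
    · obtain ⟨b, hb, hxb⟩ := mem_iUnion₂.mp h1
      rwa [hx.eq_of_mem_vert hxa.1 hxb.1]
  · exact fun h1 => Or.inr (mem_iUnion₂.mpr ⟨a, h1, hxa⟩)

omit hx in
/-- The position of a generic point relative to the vertices of `Y`: in no `D_a`, in some `R_g`,
or in some `D_a` but in no `R_g`. -/
lemma cases_Y (S : BranchingData G 𝒳) (X : Set G.Vert) (x : 𝒳) :
    (∀ a ∈ G.Y X, x ∉ S.D (Fam.vert a)) ∨ (∃ g, G.s g ∈ G.Y X ∧ x ∈ S.R g) ∨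
      ∃ a ∈ G.Y X, x ∈ S.defect a := by
  by_cases h1 : ∀ a ∈ G.Y X, x ∉ S.D (Fam.vert a)
  · exact Or.inl h1
  · push Not at h1
    obtain ⟨a, ha, hxa⟩ := h1
    by_cases h2 : x ∈ ⋃ (g : G.Edge) (_ : G.s g = a), S.R g
    · obtain ⟨g, hg, hxg⟩ := mem_iUnion₂.mp h2
      exact Or.inr (Or.inl ⟨g, hg ▸ ha, hxg⟩)
    · exact Or.inr (Or.inr ⟨a, ha, hxa, h2⟩)

lemma mem_lift_D_inter (W : (G.ext X).Fam) :
    x ∈ (S.lift hfin).D (Z.inter W) ↔ x ∈ (S.lift hfin).D Z ∧ x ∈ (S.lift hfin).D W := by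
  rcases cases_Y S X x with h | ⟨g, hg, hxg⟩ | ⟨a, ha, hxa⟩
  · simp only [hx.mem_lift_D_of_not_mem hfin _ h]
    exact hx.inter Z.base W.base
  · simp only [hx.mem_lift_D_of_mem_R hfin _ hg hxg]
    exact Iff.rfl
  · simp only [hx.mem_lift_D_of_defect hfin _ ha hxa, Fam.top_inter]
    exact Iff.rfl

lemma mem_lift_D_union (W : (G.ext X).Fam) :
    x ∈ (S.lift hfin).D (Z.union W) ↔ x ∈ (S.lift hfin).D Z ∨ x ∈ (S.lift hfin).D W := by
  rcases cases_Y S X x with h | ⟨g, hg, hxg⟩ | ⟨a, ha, hxa⟩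
  · simp only [hx.mem_lift_D_of_not_mem hfin _ h]
    exact hx.union Z.base W.base
  · simp only [hx.mem_lift_D_of_mem_R hfin _ hg hxg]
    exact Iff.rfl
  · simp only [hx.mem_lift_D_of_defect hfin _ ha hxa, Fam.top_union]
    exact Iff.rfl

lemma mem_lift_D_join (A : G.Fam) (hA : (A.1 ∩ G.Y X).Finite) :
    x ∈ (S.lift hfin).D (Fam.join A A.1 hA) ↔ x ∈ S.D A := by
  rcases cases_Y S X x with h | ⟨g, hg, hxg⟩ | ⟨a, ha, hxa⟩
  · rw [hx.mem_lift_D_of_not_mem hfin _ h, Fam.base_join]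
  · rw [hx.mem_lift_D_of_mem_R hfin _ hg hxg, Fam.base_join,
      hx.mem_D_iff (hx.R_subset g hxg)]
  · rw [hx.mem_lift_D_of_defect hfin _ ha hxa, Fam.top_join, hx.mem_D_iff hxa.1]
    exact and_iff_left ha

lemma mem_D_of_mem_lift_D (f : (G.ext X).Edge) (h : x ∈ (S.lift hfin).D (Fam.range f)) :
    x ∈ S.D (Fam.range (origin f)) := by
  rw [← Fam.range_inter_join hfin, hx.mem_lift_D_inter hfin] at h
  exact (hx.mem_lift_D_join hfin (Fam.range (origin f)) (hfin _)).mp h.2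

lemma exists_of_mem_D {e : G.Edge} (h : x ∈ S.D (Fam.range e)) :
    ∃ f : (G.ext X).Edge, origin f = e ∧ x ∈ (S.lift hfin).D (Fam.range f) := by
  rw [← hx.mem_lift_D_join hfin (Fam.range e) (hfin _)] at h
  by_cases he : (G.r e ∩ G.Y X).Nonempty
  · have h1 := Fam.range_base_union_prime hfin ⟨e, he⟩
    change _ = Fam.join (Fam.range e) (Fam.range e).1 _ at h1
    rw [← h1, hx.mem_lift_D_union hfin] at h
    exact h.elim (fun h => ⟨baseEdge e, rfl, h⟩) fun h => ⟨primeEdge ⟨e, he⟩, rfl, h⟩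
  · have h1 := Fam.range_base_eq_join hfin he
    change _ = Fam.join (Fam.range e) (Fam.range e).1 _ at h1
    rw [← h1] at h
    exact ⟨baseEdge e, rfl, h⟩

lemma mem_lift_D_source {e : G.Edge} (h : x ∈ S.R e) :
    x ∈ (S.lift hfin).D (Fam.vert (Sum.inl (G.s e))) := by
  have hs := hx.R_subset e h
  rcases cases_Y S X x with h1 | ⟨g, hg, hxg⟩ | ⟨a, ha, hxa⟩
  · rwa [hx.mem_lift_D_of_not_mem hfin _ h1, Fam.base_vert_inl]
  · rw [hx.mem_lift_D_of_mem_R hfin _ hg hxg, Fam.base_vert_inl, hx.R_unique e g h hxg]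
    rfl
  · exact absurd (mem_iUnion₂.mpr ⟨e, hx.eq_of_mem_vert hs hxa.1, h⟩) hxa.2

lemma exists_of_mem_lift_D_vert {a : G.Vert} (ha : a ∈ G.Reg)
    (h : x ∈ (S.lift hfin).D (Fam.vert (Sum.inl a))) : ∃ e, G.s e = a ∧ x ∈ S.R e := by
  rcases cases_Y S X x with h1 | ⟨g, hg, hxg⟩ | ⟨b, hb, hxb⟩
  · rw [hx.mem_lift_D_of_not_mem hfin _ h1, Fam.base_vert_inl] at h
    exact hx.D_vert a (by_contra fun haX => h1 a ⟨ha, haX⟩ h) h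
  · rw [hx.mem_lift_D_of_mem_R hfin _ hg hxg, Fam.base_vert_inl] at h
    exact ⟨g, h, hxg⟩
  · rw [hx.mem_lift_D_of_defect hfin _ hb hxb, Fam.top_vert_inl] at h
    exact h.elim

end IsGeneric

namespace IsRelBranchingSystem

variable [MeasurableSpace 𝒳] {μ : Measure 𝒳} (hS : S.IsRelBranchingSystem X μ)
  (hfin : ∀ e, (G.r e ∩ G.Y X).Finite)
include hS

/-- The set `Q_f` consists of the points of `R_e` that `f_e⁻¹` maps to `B_{r(f)}`. -/
lemma lift_R (f : (G.ext X).Edge) : (S.lift hfin).R f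
    = S.R (origin f) ∩ S.finv (origin f) ⁻¹' (S.lift hfin).D (Fam.range f) := by
  obtain ⟨e, rfl⟩ | ⟨e, rfl⟩ := edge_cases f
  · have h : (S.lift hfin).D (Fam.range (baseEdge e)) =
        (S.D (Fam.range e) \ S.D ((Fam.range e).interY hfin)) ∪
          ⋃ (g : G.Edge) (_ : G.s g ∈ G.r e ∩ G.Y X), S.R g := by
      simp only [BranchingData.lift, Fam.base_range_inl, Fam.top_range_inl]
      simp [Fam.range]
    rw [h]
    ext y
    change (y ∈ S.img e _ \ S.img e _ ∨ y ∈ S.img e _) ↔ _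
    simp only [img, baseEdge, origin, mem_inter_iff, mem_preimage, mem_sdiff, mem_union,
      Sum.elim_inl, id]
    tauto
  · have h : (S.lift hfin).D (Fam.range (primeEdge e)) =
        ⋃ (a : G.Vert) (_ : a ∈ G.r e.1 ∩ G.Y X), S.defect a := by
      simp only [BranchingData.lift, Fam.base_range_inr, Fam.top_range_inr, hS.D_empty]
      simp [Fam.empty]
    rw [h]
    rfl

lemma measurableSet_defect (a : G.Vert) : MeasurableSet (S.defect a) :=
  (hS.measurableSet_D _).diff
    (MeasurableSet.iUnion fun g => MeasurableSet.iUnion fun _ => hS.measurableSet_R g)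

lemma measurableSet_lift_D (Z : (G.ext X).Fam) : MeasurableSet ((S.lift hfin).D Z) :=
  (((hS.measurableSet_D _).diff (hS.measurableSet_D _)).union
    (MeasurableSet.iUnion fun g => MeasurableSet.iUnion fun _ => hS.measurableSet_R g)).union
    (MeasurableSet.iUnion fun a => MeasurableSet.iUnion fun _ => hS.measurableSet_defect a)

lemma lift_D_subset (f : (G.ext X).Edge) :
    (S.lift hfin).D (Fam.range f) ≤ᵐ[μ] S.D (Fam.range (origin f)) := by
  filter_upwards [hS.ae_isGeneric] with x hx h
  exact hx.mem_D_of_mem_lift_D hfin f h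

/-- The lifted system is a branching system for `G_X`. -/
theorem lift : (S.lift hfin).IsRelBranchingSystem (G.ext X).Reg μ where
  measurableSet_R f := by
    rw [hS.lift_R hfin]
    exact (hS.measurableSet_R _).inter (hS.measurable_finv _ (hS.measurableSet_lift_D hfin _))
  measurableSet_D := hS.measurableSet_lift_D hfin
  R_disjoint f f' hf := by
    filter_upwards [hS.ae_isGeneric, hS.ae_comp_finv (origin f) hS.ae_isGeneric] with x hx hx'
    refine eq_false ?_
    rintro ⟨h1, h2⟩
    rw [hS.lift_R hfin] at h1 h2
    have hff := hx.R_unique _ _ h1.1 h2.1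
    have h3 := ((hx' h1.1).mem_lift_D_inter hfin _ _).mpr ⟨h1.2, hff ▸ h2.2⟩
    rw [Fam.range_inter_range_eq_empty hff hf] at h3
    rcases h3 with (h3 | h3) | h3
    · exact (hx' h1.1).not_mem_empty h3.1
    · obtain ⟨g, hg, -⟩ := mem_iUnion₂.mp h3
      exact hg.1
    · obtain ⟨a, ha, -⟩ := mem_iUnion₂.mp h3
      exact ha.2
  D_empty := by
    simp only [BranchingData.lift, Fam.base_empty, Fam.top_empty, hS.D_empty]
    simp [Fam.empty]
  D_inter Z W := by
    filter_upwards [hS.ae_isGeneric] with x hx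
    exact propext (hx.mem_lift_D_inter hfin Z W).symm
  D_union Z W := by
    filter_upwards [hS.ae_isGeneric] with x hx
    exact propext (hx.mem_lift_D_union hfin Z W).symm
  R_subset f := by
    filter_upwards [hS.ae_isGeneric] with x hx h
    rw [hS.lift_R hfin] at h
    rw [s_ext]
    exact hx.mem_lift_D_source hfin h.1
  D_vert a ha := by
    rcases a with a | y
    · have h1 : ∀ᵐ x ∂μ, ∀ e, x ∈ S.R e → S.IsGeneric X (S.finv e x) :=
        ae_all_iff.mpr fun e => hS.ae_comp_finv e hS.ae_isGeneric
      have h2 : ∀ᵐ x ∂μ, ∀ e, x ∈ S.R e → S.finv e x ∈ S.D (Fam.range e) :=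
        ae_all_iff.mpr hS.finv_mem
      filter_upwards [hS.ae_isGeneric, h1, h2] with x hx h1 h2
      refine propext ⟨fun h => ?_, fun h => ?_⟩
      · obtain ⟨e, rfl, hxe⟩ := hx.exists_of_mem_lift_D_vert hfin (mem_Reg_ext_inl.mp ha) h
        obtain ⟨f, rfl, hf⟩ := (h1 e hxe).exists_of_mem_D hfin (h2 e hxe)
        refine mem_iUnion₂.mpr ⟨f, s_ext f, ?_⟩
        rw [hS.lift_R hfin]
        exact ⟨hxe, hf⟩
      · obtain ⟨f, hf, hxf⟩ := mem_iUnion₂.mp h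
        rw [hS.lift_R hfin] at hxf
        have h3 := hx.mem_lift_D_source hfin hxf.1
        rwa [← s_ext, hf] at h3
    · exact absurd ha (not_mem_Reg_ext_inr y)
  measurable_f f := by
    rw [S.lift_f]
    exact hS.measurable_f _
  measurable_finv f := by
    rw [S.lift_finv]
    exact hS.measurable_finv _
  f_mem f := by
    filter_upwards [hS.lift_D_subset hfin f, hS.f_mem (origin f), hS.finv_f (origin f)]
      with x h1 h2 h3 h
    rw [hS.lift_R, S.lift_f]
    refine ⟨h2 (h1 h), ?_⟩
    rw [mem_preimage, h3 (h1 h)]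
    exact h
  finv_mem f := by
    refine Filter.Eventually.of_forall fun x h => ?_
    rw [hS.lift_R] at h
    rw [S.lift_finv]
    exact h.2
  f_finv f := by
    filter_upwards [hS.f_finv (origin f)] with x hx h
    rw [hS.lift_R] at h
    rw [S.lift_f, S.lift_finv]
    exact hx h.1
  finv_f f := by
    filter_upwards [hS.lift_D_subset hfin f, hS.finv_f (origin f)] with x h1 hx h
    rw [S.lift_f, S.lift_finv]
    exact hx (h1 h)
  measurable_Φ f := by
    rw [S.lift_Φ]
    exact hS.measurable_Φ _
  measurable_Φinv f := by
    rw [S.lift_Φinv]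
    exact hS.measurable_Φinv _
  rnDeriv_f f := by
    have hB := hS.measurableSet_lift_D hfin (Fam.range f)
    have hg := hS.measurable_finv (origin f)
    have h1 : ((S.lift hfin).D (Fam.range f) ∩ S.D (Fam.range (origin f)) : Set 𝒳)
        =ᵐ[μ] (S.lift hfin).D (Fam.range f) := by
      filter_upwards [hS.lift_D_subset hfin f] with x hx
      exact propext ⟨fun h => h.1, fun h => ⟨h, hx h⟩⟩
    rw [hS.lift_R, S.lift_finv, S.lift_Φ, inter_comm, ← Measure.restrict_restrict (hg hB),
      ← Measure.restrict_map hg hB, hS.rnDeriv_f, restrict_withDensity hB,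
      Measure.restrict_restrict hB, Measure.restrict_congr_set h1]
  rnDeriv_finv f := by
    have hB := hS.measurableSet_lift_D hfin (Fam.range f)
    have hf := hS.measurable_f (origin f)
    have hE := hS.measurable_finv (origin f) hB
    have h1 : ((S.lift hfin).D (Fam.range f) : Set 𝒳) =ᵐ[μ]
        (S.f (origin f) ⁻¹' (S.finv (origin f) ⁻¹' (S.lift hfin).D (Fam.range f)) ∩
          S.D (Fam.range (origin f)) : Set 𝒳) := by
      filter_upwards [hS.lift_D_subset hfin f, hS.finv_f (origin f)] with x h1 h2
      refine propext ⟨fun h => ⟨?_, h1 h⟩, fun h => ?_⟩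
      · rw [mem_preimage, mem_preimage, h2 (h1 h)]
        exact h
      · have h3 := h.1
        rwa [mem_preimage, mem_preimage, h2 h.2] at h3
    rw [hS.lift_R, S.lift_f, S.lift_Φinv, Measure.restrict_congr_set h1,
      ← Measure.restrict_restrict (hf hE), ← Measure.restrict_map hf hE, hS.rnDeriv_finv,
      restrict_withDensity hE, Measure.restrict_restrict hE, inter_comm]

end IsRelBranchingSystem

end BranchingData

end Ultragraph

/-! ### Comparison of the induced representations -/

namespace Ultragraph

variable {G : Ultragraph.{u, v}} {X : Set G.Vert}

namespace BranchingData.IsRelBranchingSystem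

variable {𝒳 : Type w} [MeasurableSpace 𝒳] {μ : Measure 𝒳} {S : BranchingData G 𝒳}
  (hS : S.IsRelBranchingSystem X μ) (hfin : ∀ e, (G.r e ∩ G.Y X).Finite)
include hS

lemma ae_exists_of_mem_R (e : G.Edge) :
    ∀ᵐ x ∂μ, x ∈ S.R e → ∃ f : (G.ext X).Edge, origin f = e ∧ x ∈ (S.lift hfin).R f := by
  filter_upwards [hS.ae_comp_finv e hS.ae_isGeneric, hS.finv_mem e] with x h1 h2 hx
  obtain ⟨f, rfl, hf⟩ := (h1 hx).exists_of_mem_D hfin (h2 hx)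
  refine ⟨f, rfl, ?_⟩
  rw [hS.lift_R hfin]
  exact ⟨hx, hf⟩

/-- Pulling the representation of `C*(G_X)` induced by the lifted system back to `C*(G, X)` gives
the representation induced by the given system, because `D_A = B_{A ∪ (A ∩ Y)'}` and
`R_e = Q_e ∪ Q_{e'}` up to null sets. -/
lemma induces_comp {π : (G.ext X).Alg (G.ext X).Reg →⋆ₙₐ[ℂ] (Lp ℂ 2 μ →L[ℂ] Lp ℂ 2 μ)}
    (hπ : (S.lift hfin).Induces (G.ext X).Reg μ π)
    {θ : G.Alg X →⋆ₙₐ[ℂ] (G.ext X).Alg (G.ext X).Reg}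
    (hθp : ∀ A, θ (Alg.p X A) = resP hfin (Alg.p _) A)
    (hθs : ∀ e, θ (Alg.s X e) = resS (Alg.s _) e) : S.Induces X μ (π.comp θ) where
  map_p A φ := by
    rw [NonUnitalStarAlgHom.comp_apply, hθp, resP]
    refine (hπ.map_p _ φ).trans ?_
    filter_upwards [hS.ae_isGeneric] with x hx
    have h := hx.mem_lift_D_join hfin A (finite_inter_Y hfin A.2)
    by_cases hxA : x ∈ S.D A
    · rw [indicator_of_mem hxA, indicator_of_mem (h.mpr hxA)]
    · rw [indicator_of_notMem hxA, indicator_of_notMem fun h' => hxA (h.mp h')]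
  map_s e φ := by
    have hs (f : (G.ext X).Edge) : (π (Alg.s _ f) φ : 𝒳 → ℂ) =ᵐ[μ] ((S.lift hfin).R f).indicator
        (fun x => ((Real.sqrt (S.Φinv (origin f) x).toReal : ℝ) : ℂ)
          * φ (S.finv (origin f) x)) := by
      rw [← S.lift_Φinv hfin, ← S.lift_finv hfin]
      exact hπ.map_s f φ
    have hsub (f : (G.ext X).Edge) {x : 𝒳} (hx : x ∈ (S.lift hfin).R f) : x ∈ S.R (origin f) := by
      rw [hS.lift_R hfin] at hx
      exact hx.1
    rw [NonUnitalStarAlgHom.comp_apply, hθs, resS, primeVal]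
    by_cases he : (G.r e ∩ G.Y X).Nonempty
    · rw [dif_pos he, map_add]
      have hne : (baseEdge e : (G.ext X).Edge) ≠ primeEdge ⟨e, he⟩ := Sum.inl_ne_inr
      filter_upwards [hs (baseEdge e), hs (primeEdge ⟨e, he⟩),
        Lp.coeFn_add (π (Alg.s _ (baseEdge e)) φ) (π (Alg.s _ (primeEdge ⟨e, he⟩)) φ),
        hS.ae_exists_of_mem_R hfin e,
        ((hS.lift hfin).R_disjoint _ _ hne).mem_iff] with x h1 h2 h3 h4 h5
      refine h3.trans ?_
      rw [Pi.add_apply, h1, h2]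
      by_cases hx : x ∈ S.R e
      · rw [indicator_of_mem hx]
        obtain ⟨f, hf, hxf⟩ := h4 hx
        obtain ⟨e', rfl⟩ | ⟨e', rfl⟩ := edge_cases f
        · obtain rfl : e' = e := hf
          rw [indicator_of_mem hxf, indicator_of_notMem fun h => h5.mp ⟨hxf, h⟩, add_zero]
          rfl
        · obtain rfl : e'.1 = e := hf
          rw [indicator_of_mem hxf, indicator_of_notMem fun h => h5.mp ⟨h, hxf⟩, zero_add]
          rfl
      · rw [indicator_of_notMem hx, indicator_of_notMem fun h => hx (hsub _ h),
          indicator_of_notMem fun h => hx (hsub _ h), add_zero]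
    · rw [dif_neg he, add_zero]
      filter_upwards [hs (baseEdge e), hS.ae_exists_of_mem_R hfin e] with x h1 h4
      rw [h1]
      by_cases hx : x ∈ S.R e
      · rw [indicator_of_mem hx]
        obtain ⟨f, hf, hxf⟩ := h4 hx
        obtain ⟨e', rfl⟩ | ⟨e', rfl⟩ := edge_cases f
        · obtain rfl : e' = e := hf
          rw [indicator_of_mem hxf]
          rfl
        · obtain rfl : e'.1 = e := hf
          exact absurd e'.2 he
      · rw [indicator_of_notMem hx, indicator_of_notMem fun h => hx (hsub _ h)]

end BranchingData.IsRelBranchingSystem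

lemma IsPsi.unique (hX : X ⊆ G.Reg) {hfin : ∀ e, (G.r e ∩ G.Y X).Finite}
    {ψ ψ' : (G.ext X).Alg (G.ext X).Reg →⋆ₙₐ[ℂ] G.Alg X} (h : IsPsi hfin ψ) (h' : IsPsi hfin ψ') :
    ψ' = ψ := by
  rw [isPsi_iff hX] at h h'
  exact Alg.hom_ext (fun f => (h'.2 f).trans (h.2 f).symm) fun Z => (h'.1 Z).trans (h.1 Z).symm

end Ultragraph

/-- The lifted system is a `G_X`-branching system; the representations `η`, `π` induced by the given
and the lifted system and the isomorphism `ψ` exist and are unique, and `π = η ∘ ψ`. -/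
theorem mainTheorem4 (G : Ultragraph.{u, v}) (X : Set G.Vert) (hX : X ⊆ G.Reg)
    (hfin : ∀ e, (G.r e ∩ G.Y X).Finite)
    {𝒳 : Type w} [MeasurableSpace 𝒳] (μ : Measure 𝒳) (S : Ultragraph.BranchingData G 𝒳)
    (hS : S.IsRelBranchingSystem X μ) :
    (S.lift hfin).IsRelBranchingSystem (G.ext X).Reg μ ∧
    ∃ (η : G.Alg X →⋆ₙₐ[ℂ] (Lp ℂ 2 μ →L[ℂ] Lp ℂ 2 μ))
      (π : (G.ext X).Alg (G.ext X).Reg →⋆ₙₐ[ℂ] (Lp ℂ 2 μ →L[ℂ] Lp ℂ 2 μ))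
      (ψ : (G.ext X).Alg (G.ext X).Reg →⋆ₙₐ[ℂ] G.Alg X),
      (∀ η', S.Induces X μ η' ↔ η' = η) ∧
      (∀ π', (S.lift hfin).Induces (G.ext X).Reg μ π' ↔ π' = π) ∧
      (∀ ψ' : (G.ext X).Alg (G.ext X).Reg →⋆ₙₐ[ℂ] G.Alg X,
        Ultragraph.IsPsi hfin ψ' ↔ ψ' = ψ) ∧
      Function.Bijective ψ ∧
      π = η.comp ψ := by
  obtain ⟨η, hη⟩ := hS.exists_unique_induces hX
  obtain ⟨π, hπ⟩ := (hS.lift hfin).exists_unique_induces subset_rfl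
  obtain ⟨ψ, θ, hψ, hθp, hθs, hψθ, hθψ⟩ := Ultragraph.exists_iso hX hfin
  refine ⟨hS.lift hfin, η, π, ψ, hη, hπ,
    fun ψ' => ⟨fun h => hψ.unique hX h, fun h => h ▸ hψ⟩,
    Function.bijective_iff_has_inverse.mpr ⟨θ, hθψ, hψθ⟩, ?_⟩
  have h := (hη _).mp (hS.induces_comp hfin ((hπ π).mpr rfl) hθp hθs)
  ext1 z
  rw [← h, NonUnitalStarAlgHom.comp_apply, NonUnitalStarAlgHom.comp_apply, hθψ]
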